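/- Let $L\ge 1$. Two time-homogeneous Markov processes $(x_t)_{t\ge0}$ on $\Omega$ and $(\xi_t)_{t\ge0}$ on $\Omega_{Dual}$ are \emph{dual} with duality function $D$ if, for all $t\ge 0$, $x\in\Omega$, $\xi\in\Omega_{Dual}$, both expectations below are finite and $$\mathbb E_x[D(x_t,\xi)]=\mathbb E_\xi[D(x,\xi_t)].$$ In each case below the given operators are generators of unique Markov processes (unique as transition functions; the generator being the derivative at time $0$, in supremum norm, on all bounded measurable functions). Write $\xi=(\xi_0,\xi_1,\dots,\xi_L,\xi_{L+1})$. For $1\le i\le L-1$ let $x^{i;r,s}$ be $x$ with $x_i,x_{i+1}$ replaced by $r,s$, and let $x^{i\leftarrow r}$ be $x$ with $x_i$ replaced by $r$. For a probability kernel $\nu(r\,|\,E)$ on $\{0,\dots,E\}$ put $$\mathcal B_\nu f(\eta)=\sum_{i=1}^{L-1}\sum_{r=0}^{\eta_i+\eta_{i+1}}\bigl[f(\eta^{i;r,\eta_i+\eta_{i+1}-r})-f(\eta)\bigr]\,\nu(r\,|\,\eta_i+\eta_{i+1}),$$ (terms with $\nu=0$ being omitted), and let $\mathcal B_\nu$ act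 on functions of $\xi$ through $(\xi_1,\dots,\xi_L)$. The dual generator in all cases is, with the $\nu$ indicated, $$\mathcal L_{Dual}f(\xi)=[f(\xi_0+\xi_1,0,\xi_2,\dots,\xi_{L+1})-f(\xi)]+\mathcal B_\nu f(\xi)+[f(\xi_0,\dots,\xi_{L-1},0,\xi_L+\xi_{L+1})-f(\xi)].$$ For a probability law $\pi_a$ (resp. $\pi_b$) let $\mathcal R_{\pi_a}f(x)=\int [f(x^{1\leftarrow r})-f(x)]\,\pi_a(dr)$ and $\mathcal R_{\pi_b}f(x)=\int [f(x^{L\leftarrow r})-f(x)]\,\pi_b(dr)$. The quotient $\eta!/(\eta-\xi)!$ is $0$ if $\xi>\eta$. 1. (Th-SIP$(2k)$) Let $k>0$, $0<\alpha<\gamma$, $0<\delta<\beta$. The process on $\mathbb N_0^L$ with generator $\mathcal R_{\pi_a}+\mathcal B_\nu+\mathcal R_{\pi_b}$, where $\pi_a(r)=\binom{2k+r-1}{r}(\frac\alpha\gamma)^r(\frac{\gamma-\alpha}{\gamma})^{2k}$, $\pi_b(r)=\binom{2k+r-1}{r}(\frac\delta\beta)^r(\frac{\beta-\delta}{\beta})^{2k}$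 and $\nu=\nu^{SIP}_{2k}$, $\nu^{SIP}_{2k}(r|E)=\binom{2k+r-1}{r}\binom{2k+E-r-1}{E-r}/\binom{4k+E-1}{E}$, is dual to the process on $\mathbb N_0^{L+2}$ with generator $\mathcal L_{Dual}$, $\nu=\nu^{SIP}_{2k}$, with duality function $$D(\eta,\xi)=\Bigl(\tfrac{\alpha}{\gamma-\alpha}\Bigr)^{\xi_0}\prod_{i=1}^L\frac{\eta_i!}{(\eta_i-\xi_i)!}\frac{\Gamma(2k)}{\Gamma(2k+\xi_i)}\Bigl(\tfrac{\delta}{\beta-\delta}\Bigr)^{\xi_{L+1}}.$$ 2. (Th-SEP$(2j)$) Let $2j\in\mathbb N_0$ and $\alpha,\gamma,\delta,\beta>0$. The process on $\{0,\dots,2j\}^L$ with generator $\mathcal R_{\pi_a}+\mathcal B_\nu+\mathcal R_{\pi_b}$, where $\pi_a(r)=\binom{2j}{r}(\frac\alpha\gamma)^r(\frac{\gamma}{\gamma+\alpha})^{2j}$, $\pi_b(r)=\binom{2j}{r}(\frac\delta\beta)^r(\frac{\beta}{\beta+\delta})^{2j}$ for $0\le r\le 2j$ and $\nu(r|E)=\binom{2j}{r}\binom{2j}{E-r}/\binom{4j}{E}$,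 is dual to the process on $\mathbb N_0\times\{0,\dots,2j\}^L\times\mathbb N_0$ with generator $\mathcal L_{Dual}$, with the same $\nu$, with duality function $$D(\eta,\xi)=\Bigl(\tfrac{\alpha}{\alpha+\gamma}\Bigr)^{\xi_0}\prod_{i=1}^L\frac{\eta_i!}{(\eta_i-\xi_i)!}\frac{\Gamma(2j+1-\xi_i)}{\Gamma(2j+1)}\Bigl(\tfrac{\delta}{\beta+\delta}\Bigr)^{\xi_{L+1}}.$$ 3. (Th-IRW) Let $\alpha,\gamma,\delta,\beta>0$. The process on $\mathbb N_0^L$ with generator $\mathcal R_{\pi_a}+\mathcal B_\nu+\mathcal R_{\pi_b}$, where $\pi_a(r)=(\frac\alpha\gamma)^r e^{-\alpha/\gamma}/r!$, $\pi_b(r)=(\frac\delta\beta)^r e^{-\delta/\beta}/r!$ and $\nu(r|E)=\binom Er2^{-E}$, is dual to the process on $\mathbb N_0^{L+2}$ with generator $\mathcal L_{Dual}$, with the same $\nu$, with duality function $$D(\eta,\xi)=\Bigl(\tfrac{\alpha}{\gamma}\Bigr)^{\xi_0}\prod_{i=1}^L\frac{\eta_i!}{(\eta_i-\xi_i)!}\Bigl(\tfrac{\delta}{\beta}\Bigr)^{\xi_{L+1}}.$$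 4. (Th-BEP$(2k)$) Let $k,T_a,T_b>0$. The process on $[0,\infty)^L$ with generator $$\mathcal R_{\pi_a}f(z)+\sum_{i=1}^{L-1}\int_0^1\bigl[f(z^{i;\,x(z_i+z_{i+1}),(1-x)(z_i+z_{i+1})})-f(z)\bigr]\nu(x)\,dx+\mathcal R_{\pi_b}f(z),$$ where $\nu$ is the density of the Beta$(2k,2k)$ law and $\pi_a,\pi_b$ are the Gamma laws with shape $2k$ and scales $2T_a$, $2T_b$, is dual to the process on $\mathbb N_0^{L+2}$ with generator $\mathcal L_{Dual}$, $\nu=\nu^{SIP}_{2k}$, with duality function $$D(z,\xi)=(2T_a)^{\xi_0}\prod_{i=1}^L z_i^{\xi_i}\frac{\Gamma(2k)}{\Gamma(2k+\xi_i)}(2T_b)^{\xi_{L+1}}.$$ 5. (KMP) Let $T_a,T_b>0$. For $k=\frac12$ and temperatures $T_a/2,T_b/2$, the generator in 4 is the KMP generator: uniform redistribution of the energy on each bond, and exponential reservoirs with means $T_a,T_b$. Its dual generator is $\mathcal L_{Dual}$ with the uniform law $\nu(r|E)=1/(E+1)$, and the duality function in 4 becomes $T_a^{\xi_0}\prod_{i=1}^L\frac{z_i^{\xi_i}}{\xi_i!}\,T_b^{\xi_{L+1}}$.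 In particular KMP is dual to this process with this function. -/

import Mathlib

open MeasureTheory ProbabilityTheory Filter Topology
open scoped NNReal

noncomputable section

namespace ThermalDuality

/-! ### Markov processes, generators and duality of processes -/

/-- A family of kernels `P t`, `t ≥ 0`, is the transition function of a time-homogeneous Markov
process on `S`: every `P t` is a probability kernel, `P 0` is the identity and
Chapman-Kolmogorov holds. `P t x` is the law at time `t` of the process started from `x`, so the
expectation of `f` at time `t` is `∫ y, f y ∂(P t x)`. -/
structure IsMarkovTransition {S : Type*} [MeasurableSpace S] (P : ℝ≥0 → Kernel S S) : Prop where
  isMarkov : ∀ t, IsMarkovKernel (P t)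
  zero : P 0 = Kernel.id
  chapman_kolmogorov : ∀ s t, P (s + t) = P t ∘ₖ P s

/-- `P` is the transition function of the Markov process with generator `G`. (All generators
below are bounded operators, so that the generator is the derivative at time `0`, in the
supremum norm, on all bounded measurable functions.) -/
structure IsProcessGeneratedBy {S : Type*} [MeasurableSpace S]
    (G : (S → ℝ) → S → ℝ) (P : ℝ≥0 → Kernel S S) : Prop extends IsMarkovTransition P where
  generator : ∀ f : S → ℝ, Measurable f → (∃ C : ℝ, ∀ x, |f x| ≤ C) →
    TendstoUniformly (fun (h : ℝ≥0) (x : S) => ((∫ y, f y ∂(P h x)) - f x) / (h : ℝ))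
      (G f) (𝓝[>] 0)

/-- The operators `G` and `G'` generate Markov processes `x_t` and `y_t` (each of them exists and
is unique in law), and these are dual with duality function `D`:
`E_x [D (x_t, y)] = E_y [D (x, y_t)]` for all `t ≥ 0`, `x` and `y`, where the expectations of
the duality function are finite. -/
structure GenerateDualProcesses {S S' : Type*} [MeasurableSpace S] [MeasurableSpace S']
    (G : (S → ℝ) → S → ℝ) (G' : (S' → ℝ) → S' → ℝ) (D : S → S' → ℝ) : Prop where
  process : ∃! P : ℝ≥0 → Kernel S S, IsProcessGeneratedBy G P
  dualProcess : ∃! Q : ℝ≥0 → Kernel S' S', IsProcessGeneratedBy G' Q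
  duality : ∀ (P : ℝ≥0 → Kernel S S) (Q : ℝ≥0 → Kernel S' S'),
    IsProcessGeneratedBy G P → IsProcessGeneratedBy G' Q →
    ∀ (t : ℝ≥0) (x : S) (y : S'),
      Integrable (fun x' => D x' y) (P t x) ∧ Integrable (fun y' => D x y') (Q t y) ∧
        ∫ x', D x' y ∂(P t x) = ∫ y', D x y' ∂(Q t y)

/-! ### Configurations

The chain has `L = n + 1` sites; site `i + 1` of the chain is the index `i : Fin (n + 1)`, so the
first site is `0`, the last site is `Fin.last n`, and the bonds are the pairs
`(i.castSucc, i.succ)`, `i : Fin n`. -/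

/-- A configuration of occupation numbers or energies in `S` on the `L = n + 1` bulk sites. -/
abbrev Config (n : ℕ) (S : Type) : Type := Fin (n + 1) → S

/-- A dual configuration `(ξ₀, (ξ₁, …, ξ_L), ξ_{L+1})`, with two extra boundary sites that can
hold any number of particles. -/
abbrev DualConfig (n : ℕ) (S : Type) : Type := ℕ × Config n S × ℕ

/-- Replace the two values on the bond `i` by `r` and `s`. -/
def setBond {n : ℕ} {S : Type} (η : Config n S) (i : Fin n) (r s : S) : Config n S :=
  Function.update (Function.update η i.castSucc r) i.succ s

/-- The generator of absorption: at rate `1` all particles of the first site are moved to the left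
boundary site, and at rate `1` all particles of the last site are moved to the right boundary
site. -/
def absorb {n : ℕ} {S : Type} [Zero S] (toNat : S → ℕ)
    (f : DualConfig n S → ℝ) (ξ : DualConfig n S) : ℝ :=
  (f (ξ.1 + toNat (ξ.2.1 0), Function.update ξ.2.1 0 0, ξ.2.2) - f ξ)
  + (f (ξ.1, Function.update ξ.2.1 (Fin.last n) 0, toNat (ξ.2.1 (Fin.last n)) + ξ.2.2) - f ξ)

/-- Bulk redistribution for unbounded occupation numbers: on every bond, at rate `1`, the total
number `E` of particles is redistributed as `(r, E - r)` with probability `ν r E`. -/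
def bulk (ν : ℕ → ℕ → ℝ) {n : ℕ} (f : Config n ℕ → ℝ) (η : Config n ℕ) : ℝ :=
  ∑ i : Fin n, ∑ r ∈ Finset.range (η i.castSucc + η i.succ + 1),
    (f (setBond η i r (η i.castSucc + η i.succ - r)) - f η) * ν r (η i.castSucc + η i.succ)

/-! ### Thermalized inclusion walkers -/

/-- The negative hypergeometric distribution
`binom(2k+r-1, r) binom(2k+E-r-1, E-r) / binom(4k+E-1, E)`, `0 ≤ r ≤ E`. -/
def nuSIP (k : ℝ) (r E : ℕ) : ℝ :=
  Ring.choose (2 * k + r - 1) r * Ring.choose (2 * k + (E - r : ℕ) - 1) (E - r)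
    / Ring.choose (4 * k + E - 1) E

/-- The negative binomial distribution with parameters `2k` and `a / c`. -/
def negBinomial (k a c : ℝ) (r : ℕ) : ℝ :=
  Ring.choose (2 * k + r - 1) r * (a / c) ^ r * ((c - a) / c) ^ (2 * k)

/-- The generator of Th-SIP(2k). -/
def thSIP (n : ℕ) (k α γ δ β : ℝ) (f : Config n ℕ → ℝ) (η : Config n ℕ) : ℝ :=
  (∑' r : ℕ, (f (Function.update η 0 r) - f η) * negBinomial k α γ r)
  + bulk (nuSIP k) f η
  + ∑' r : ℕ, (f (Function.update η (Fin.last n) r) - f η) * negBinomial k δ β r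

/-- The generator of the dual of Th-SIP(2k). -/
def thSIPDual (n : ℕ) (k : ℝ) (f : DualConfig n ℕ → ℝ) (ξ : DualConfig n ℕ) : ℝ :=
  absorb id f ξ + bulk (nuSIP k) (fun ζ => f (ξ.1, ζ, ξ.2.2)) ξ.2.1

/-- The duality function of SIP(2k); `η! / (η - ξ)!` is read as `0` when `ξ > η`. -/
def dSIP (n : ℕ) (k α γ δ β : ℝ) (η : Config n ℕ) (ξ : DualConfig n ℕ) : ℝ :=
  (α / (γ - α)) ^ ξ.1
  * (∏ i, ((η i).descFactorial (ξ.2.1 i) : ℝ)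
      * (Real.Gamma (2 * k) / Real.Gamma (2 * k + ξ.2.1 i)))
  * (δ / (β - δ)) ^ ξ.2.2

/-! ### Thermalized exclusion walkers, `N = 2j` -/

/-- The hypergeometric distribution `binom(2j, r) binom(2j, E-r) / binom(4j, E)`. -/
def nuSEP (N r E : ℕ) : ℝ :=
  (N.choose r : ℝ) * (N.choose (E - r) : ℝ) / ((2 * N).choose E : ℝ)

/-- The binomial distribution with parameters `2j` and `a / (c + a)`. -/
def binomialRes (N : ℕ) (a c : ℝ) (r : ℕ) : ℝ :=
  (N.choose r : ℝ) * (a / c) ^ r * (c / (c + a)) ^ N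

/-- Bulk redistribution of Th-SEP(2j): on every bond, at rate `1`, the total number `E` of
particles is redistributed as `(r, s)`, `r + s = E` and `r, s ≤ 2j`, with probability
`nuSEP N r E`. -/
def bulkSEP {n N : ℕ} (f : Config n (Fin (N + 1)) → ℝ) (η : Config n (Fin (N + 1))) : ℝ :=
  ∑ i : Fin n, ∑ p : Fin (N + 1) × Fin (N + 1)
      with (p.1 : ℕ) + (p.2 : ℕ) = (η i.castSucc : ℕ) + (η i.succ : ℕ),
    (f (setBond η i p.1 p.2) - f η) * nuSEP N p.1 ((η i.castSucc : ℕ) + (η i.succ : ℕ))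

/-- The generator of Th-SEP(2j). -/
def thSEP (n N : ℕ) (α γ δ β : ℝ) (f : Config n (Fin (N + 1)) → ℝ)
    (η : Config n (Fin (N + 1))) : ℝ :=
  (∑ r : Fin (N + 1), (f (Function.update η 0 r) - f η) * binomialRes N α γ r)
  + bulkSEP f η
  + ∑ r : Fin (N + 1), (f (Function.update η (Fin.last n) r) - f η) * binomialRes N δ β r

/-- The generator of the dual of Th-SEP(2j). -/
def thSEPDual (n N : ℕ) (f : DualConfig n (Fin (N + 1)) → ℝ)
    (ξ : DualConfig n (Fin (N + 1))) : ℝ :=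
  absorb Fin.val f ξ + bulkSEP (fun ζ => f (ξ.1, ζ, ξ.2.2)) ξ.2.1

/-- The duality function of SEP(2j). -/
def dSEP (n N : ℕ) (α γ δ β : ℝ) (η : Config n (Fin (N + 1)))
    (ξ : DualConfig n (Fin (N + 1))) : ℝ :=
  (α / (α + γ)) ^ ξ.1
  * (∏ i, ((η i : ℕ).descFactorial (ξ.2.1 i : ℕ) : ℝ)
      * (Real.Gamma (N + 1 - (ξ.2.1 i : ℕ)) / Real.Gamma (N + 1)))
  * (δ / (β + δ)) ^ ξ.2.2

/-! ### Thermalized independent walkers -/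

/-- The binomial distribution with parameters `E` and `1/2`. -/
def nuIRW (r E : ℕ) : ℝ := (E.choose r : ℝ) * (1 / 2 ^ E)

/-- The Poisson distribution with parameter `a / c`. -/
def poissonRes (a c : ℝ) (r : ℕ) : ℝ :=
  (a / c) ^ r * (Real.exp (-(a / c)) / (r.factorial : ℝ))

/-- The generator of Th-IRW. -/
def thIRW (n : ℕ) (α γ δ β : ℝ) (f : Config n ℕ → ℝ) (η : Config n ℕ) : ℝ :=
  (∑' r : ℕ, (f (Function.update η 0 r) - f η) * poissonRes α γ r)
  + bulk nuIRW f η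
  + ∑' r : ℕ, (f (Function.update η (Fin.last n) r) - f η) * poissonRes δ β r

/-- The generator of the dual of Th-IRW. -/
def thIRWDual (n : ℕ) (f : DualConfig n ℕ → ℝ) (ξ : DualConfig n ℕ) : ℝ :=
  absorb id f ξ + bulk nuIRW (fun ζ => f (ξ.1, ζ, ξ.2.2)) ξ.2.1

/-- The duality function of IRW. -/
def dIRW (n : ℕ) (α γ δ β : ℝ) (η : Config n ℕ) (ξ : DualConfig n ℕ) : ℝ :=
  (α / γ) ^ ξ.1 * (∏ i, ((η i).descFactorial (ξ.2.1 i) : ℝ)) * (δ / β) ^ ξ.2.2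

/-! ### Thermalized Brownian energy process and KMP -/

/-- The Gamma density with shape `2k` and scale `2T`, the stationary law of the energy reservoir
at temperature `T`. -/
def gammaRes (k T z : ℝ) : ℝ :=
  1 / ((2 * T) ^ (2 * k) * Real.Gamma (2 * k)) * z ^ (2 * k - 1) * Real.exp (-z / (2 * T))

/-- The generator of Th-BEP(2k); `betaPDFReal (2k) (2k)` is the density of Beta(2k,2k). -/
def thBEP (n : ℕ) (k Ta Tb : ℝ) (f : Config n ℝ≥0 → ℝ) (z : Config n ℝ≥0) : ℝ :=
  (∫ z' in Set.Ioi (0 : ℝ), gammaRes k Ta z' * (f (Function.update z 0 z'.toNNReal) - f z))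
  + (∑ i : Fin n, ∫ x in (0 : ℝ)..1,
      (f (setBond z i (x.toNNReal * (z i.castSucc + z i.succ))
        ((1 - x).toNNReal * (z i.castSucc + z i.succ))) - f z) * betaPDFReal (2 * k) (2 * k) x)
  + ∫ z' in Set.Ioi (0 : ℝ),
      gammaRes k Tb z' * (f (Function.update z (Fin.last n) z'.toNNReal) - f z)

/-- The generator of the dual of Th-BEP(2k): the bulk is that of Th-SIP(2k). -/
def thBEPDual (n : ℕ) (k : ℝ) (f : DualConfig n ℕ → ℝ) (ξ : DualConfig n ℕ) : ℝ :=
  absorb id f ξ + bulk (nuSIP k) (fun ζ => f (ξ.1, ζ, ξ.2.2)) ξ.2.1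

/-- The duality function of BEP(2k). -/
def dBEP (n : ℕ) (k Ta Tb : ℝ) (z : Config n ℝ≥0) (ξ : DualConfig n ℕ) : ℝ :=
  (2 * Ta) ^ ξ.1
  * (∏ i, (z i : ℝ) ^ (ξ.2.1 i) * (Real.Gamma (2 * k) / Real.Gamma (2 * k + ξ.2.1 i)))
  * (2 * Tb) ^ ξ.2.2

/-- The generator of the KMP model: uniform redistribution on every bond, exponential reservoirs
with mean energies `Ta` and `Tb`. -/
def kmp (n : ℕ) (Ta Tb : ℝ) (f : Config n ℝ≥0 → ℝ) (z : Config n ℝ≥0) : ℝ :=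
  (∫ z' in Set.Ioi (0 : ℝ),
      Real.exp (-z' / Ta) / Ta * (f (Function.update z 0 z'.toNNReal) - f z))
  + (∑ i : Fin n, ∫ x in (0 : ℝ)..1,
      (f (setBond z i (x.toNNReal * (z i.castSucc + z i.succ))
        ((1 - x).toNNReal * (z i.castSucc + z i.succ))) - f z))
  + ∫ z' in Set.Ioi (0 : ℝ),
      Real.exp (-z' / Tb) / Tb * (f (Function.update z (Fin.last n) z'.toNNReal) - f z)

/-- The uniform distribution on `0, …, E`. -/
def nuUniform (_r E : ℕ) : ℝ := 1 / ((E : ℝ) + 1)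

/-- The generator of the dual of the KMP model. -/
def kmpDual (n : ℕ) (f : DualConfig n ℕ → ℝ) (ξ : DualConfig n ℕ) : ℝ :=
  absorb id f ξ + bulk nuUniform (fun ζ => f (ξ.1, ζ, ξ.2.2)) ξ.2.1

/-- The duality function of the KMP model. -/
def dKMP (n : ℕ) (Ta Tb : ℝ) (z : Config n ℝ≥0) (ξ : DualConfig n ℕ) : ℝ :=
  Ta ^ ξ.1 * (∏ i, (z i : ℝ) ^ (ξ.2.1 i) / ((ξ.2.1 i).factorial : ℝ)) * Tb ^ ξ.2.2

end ThermalDuality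

end

/-! Every generator here is bounded: on bounded measurable functions it is `G f = ∫ f dK - c f`,
where the jump kernel `K` has constant mass `c = n + 2`, one unit for each of the `n` bonds and the
two reservoirs (for the dual, the two absorbing ends). The process exists as the exponential series
`e^{-ct} ∑ t^m K^m / m!` (`jumpSemigroup`). It is unique because two transition functions with the
same bounded generator differ at time `t` by at most a constant times `(M t)^m / m!`, for every `m`.

Duality at time `t` is thereby reduced to duality of one jump, `∫ D(x', y) K(x, dx') = ∫ D(x, y')
K'(y, dy')`, which passes to powers of the kernels by Tonelli and then to the series. The function
`D` is unbounded but nonnegative, so this is done with extended integrals. Finiteness comes from the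
dual side: the dual jumps conserve the total number of particles, only finitely many dual
configurations have a given number, and so `D(x, ·)` is bounded along the dual process.

Since `D` is a product over sites, one-jump duality splits into relations for a single reservoir and
a single bond (`LocalDuality`). A reservoir must satisfy `∫ d(r, m) π(dr) = A^m`, the weight of `m`
absorbed particles. On a bond, redistributing `(x, y)` and redistributing `(m, l)` must give the
same average of `d ⊗ d`.

For particles, `d(x, m) = binom(x, m) / w(m)` and the redistribution has weights `w(r) w(s) / W(E)`,
`W` being the convolution square of `w`. Both bond averages equal `binom(x + y, m + l) / W(m + l)`:
on the dual side the weights cancel and Vandermonde remains (`dual_bond_sum`), on the other side one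
computes factorial moments (`IsThermalWeight.bond_sum`). The weights are `multichoose (2k) r`
(inclusion), `binom(N, r)` (exclusion) and `1 / r!` (independent walkers). For energies a Beta
integral on one side meets the binomial theorem on the other (`energy_bond_sum`). KMP is the case `k
= 1/2`. -/

noncomputable section

namespace ThermalDuality

open scoped ENNReal

/-! ### Uniqueness of the transition function of a bounded generator -/

section Uniqueness

variable {S : Type*} [MeasurableSpace S] {G : (S → ℝ) → S → ℝ} {P Q : ℝ≥0 → Kernel S S}

theorem integrable_of_bounded {μ : Measure S} [IsFiniteMeasure μ] {f : S → ℝ}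
    (hf : Measurable f) {C : ℝ} (hC : ∀ x, |f x| ≤ C) : Integrable f μ :=
  Integrable.of_bound hf.aestronglyMeasurable C (ae_of_all _ hC)

theorem abs_integral_le_of_bounded {μ : Measure S} [IsProbabilityMeasure μ] {f : S → ℝ} {C : ℝ}
    (hC : ∀ x, |f x| ≤ C) : |∫ y, f y ∂μ| ≤ C := by
  simpa using norm_integral_le_of_norm_le_const (μ := μ) (f := f) (ae_of_all _ hC)

/-- An operator that maps measurable functions bounded by `C` to measurable functions bounded
by `M * C`. -/
def IsBoundedOperator (G : (S → ℝ) → S → ℝ) (M : ℝ) : Prop :=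
  ∀ f : S → ℝ, Measurable f → ∀ C : ℝ, (∀ x, |f x| ≤ C) →
    Measurable (G f) ∧ ∀ x, |G f x| ≤ M * C

theorem IsProcessGeneratedBy.exists_increment_bound (hP : IsProcessGeneratedBy G P) {f : S → ℝ}
    (hf : Measurable f) {C : ℝ} (hC : ∀ x, |f x| ≤ C) {ε : ℝ} (hε : 0 < ε) :
    ∃ δ > 0, ∀ h : ℝ≥0, 0 < h → (h : ℝ) < δ →
      ∀ x, |(∫ y, f y ∂(P h x)) - f x - h * G f x| ≤ ε * h := by
  have := Metric.tendstoUniformly_iff.1 (hP.generator f hf ⟨C, hC⟩) ε hε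
  rw [eventually_nhdsWithin_iff, Metric.eventually_nhds_iff] at this
  obtain ⟨δ, hδ, H⟩ := this
  refine ⟨δ, hδ, fun h h0 hh x => ?_⟩
  have h0' : (0 : ℝ) < h := h0
  have := H (y := h) (by simpa [NNReal.dist_eq] using hh) h0 x
  rw [dist_comm, Real.dist_eq] at this
  have e : (∫ y, f y ∂(P h x)) - f x - h * G f x
      = (((∫ y, f y ∂(P h x)) - f x) / h - G f x) * h := by field_simp
  rw [e, abs_mul, abs_of_pos h0']
  exact mul_le_mul_of_nonneg_right this.le h0'.le

theorem IsMarkovTransition.integral_add (hP : IsMarkovTransition P) {f : S → ℝ}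
    (hf : Measurable f) {C : ℝ} (hC : ∀ x, |f x| ≤ C) (s t : ℝ≥0) (x : S) :
    ∫ y, f y ∂(P (s + t) x) = ∫ z, ∫ y, f y ∂(P t z) ∂(P s x) := by
  have := hP.isMarkov
  rw [hP.chapman_kolmogorov]
  exact Kernel.integral_comp (integrable_of_bounded hf hC)

theorem IsMarkovTransition.measurable_integral (hP : IsMarkovTransition P) {f : S → ℝ}
    (hf : Measurable f) (t : ℝ≥0) : Measurable fun x => ∫ y, f y ∂(P t x) := by
  have := hP.isMarkov
  exact (hf.stronglyMeasurable.integral_kernel (κ := P t)).measurable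

/-- By Chapman-Kolmogorov the increment from `t` to `t + h` is the average over `P t x` of the
increment from `0` to `h`. The bound at time `0` is uniform in the starting point, so it survives
the averaging. -/
theorem IsProcessGeneratedBy.abs_integral_add_sub_le (hP : IsProcessGeneratedBy G P)
    {f : S → ℝ} (hf : Measurable f) {C : ℝ} (hC : ∀ x, |f x| ≤ C) {g : S → ℝ}
    (hg : Measurable g) {B : ℝ} (hB : ∀ x, |g x| ≤ B) {ε : ℝ} {h : ℝ≥0}
    (H : ∀ x, |(∫ y, f y ∂(P h x)) - f x - h * g x| ≤ ε * h) (t : ℝ≥0) (x : S) :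
    |(∫ y, f y ∂(P (t + h) x)) - (∫ y, f y ∂(P t x)) - h * ∫ y, g y ∂(P t x)| ≤ ε * h := by
  have := hP.isMarkov
  have i1 : Integrable (fun z => ∫ y, f y ∂(P h z)) (P t x) :=
    integrable_of_bounded (hP.measurable_integral hf h) fun z => abs_integral_le_of_bounded hC
  have i2 : Integrable f (P t x) := integrable_of_bounded hf hC
  have i3 : Integrable (fun z => h * g z) (P t x) := (integrable_of_bounded hg hB).const_mul _
  rw [hP.integral_add hf hC, ← integral_const_mul, ← integral_sub i1 i2,
    ← integral_sub (f := fun z => (∫ y, f y ∂(P h z)) - f z) (i1.sub i2) i3]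
  exact abs_integral_le_of_bounded H

/-- The generator only gives a right derivative, which does not imply left continuity. The two-sided
statement comes from a local Lipschitz bound with constant `1 + M * C`. -/
theorem IsProcessGeneratedBy.continuous_integral {M : ℝ} (hG : IsBoundedOperator G M)
    (hP : IsProcessGeneratedBy G P) {f : S → ℝ} (hf : Measurable f) {C : ℝ}
    (hC : ∀ x, |f x| ≤ C) (x : S) :
    Continuous fun t : ℝ => ∫ y, f y ∂(P t.toNNReal x) := by
  obtain ⟨hg, hB⟩ := hG f hf C hC
  obtain ⟨δ, hδ, H⟩ := hP.exists_increment_bound hf hC one_pos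
  have hM : 0 ≤ M * C := (abs_nonneg _).trans (hB x)
  have := hP.isMarkov
  have key : ∀ s t : ℝ, s ≤ t → t - s < δ →
      |(∫ y, f y ∂(P t.toNNReal x)) - ∫ y, f y ∂(P s.toNNReal x)| ≤ (1 + M * C) * (t - s) := by
    intro s t hst hd
    obtain ⟨h, hh⟩ := exists_add_of_le (Real.toNNReal_le_toNNReal hst)
    have hle : (h : ℝ) ≤ t - s := by
      have : (h : ℝ) = (t.toNNReal : ℝ) - s.toNNReal := by rw [hh]; push_cast; ring
      rw [this, Real.coe_toNNReal', Real.coe_toNNReal']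
      rcases le_total s 0 with h1 | h1 <;> rcases le_total t 0 with h2 | h2 <;> simp [h1, h2] <;>
        linarith
    -- The increment bound needs `h > 0`; `h = 0` occurs when `s = t` and when both times are
    -- nonpositive, where `toNNReal` is constant.
    rcases eq_zero_or_pos h with rfl | h0
    · rw [hh]; simp; nlinarith
    have h1 := hP.abs_integral_add_sub_le hf hC hg hB (H h h0 (hle.trans_lt hd)) s.toNNReal x
    have h2 : |∫ y, G f y ∂(P s.toNNReal x)| ≤ M * C := abs_integral_le_of_bounded hB
    rw [← hh] at h1
    have h0' : (0 : ℝ) ≤ h := h.2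
    have h3 : |(h : ℝ) * ∫ y, G f y ∂(P s.toNNReal x)| ≤ h * (M * C) := by
      rw [abs_mul, abs_of_nonneg h0']; gcongr
    rw [abs_le] at h1 h3 ⊢
    constructor <;> nlinarith
  rw [Metric.continuous_iff]
  intro t ε hε
  refine ⟨min δ (ε / (1 + M * C)), by positivity, fun s hs => ?_⟩
  rw [Real.dist_eq] at hs ⊢
  obtain ⟨hs1, hs2⟩ := lt_min_iff.1 hs
  rw [lt_div_iff₀ (by positivity)] at hs2
  rcases le_total s t with h | h
  · rw [abs_sub_comm] at hs1 hs2 ⊢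
    rw [abs_of_nonneg (by linarith)] at hs1 hs2
    have := key s t h hs1
    linarith
  · rw [abs_of_nonneg (by linarith)] at hs1 hs2
    have := key t s h hs1
    linarith

/-- The forward equation `d/dt P_t f = P_t (G f)`, from the right. -/
theorem IsProcessGeneratedBy.hasDerivWithinAt_integral {M : ℝ} (hG : IsBoundedOperator G M)
    (hP : IsProcessGeneratedBy G P) {f : S → ℝ} (hf : Measurable f) {C : ℝ}
    (hC : ∀ x, |f x| ≤ C) (x : S) {t : ℝ} (ht : 0 ≤ t) :
    HasDerivWithinAt (fun t : ℝ => ∫ y, f y ∂(P t.toNNReal x))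
      (∫ y, G f y ∂(P t.toNNReal x)) (Set.Ici t) t := by
  obtain ⟨hg, hB⟩ := hG f hf C hC
  rw [← hasDerivWithinAt_Ioi_iff_Ici, hasDerivWithinAt_iff_tendsto_slope' (by simp),
    Metric.tendsto_nhdsWithin_nhds]
  intro ε hε
  obtain ⟨δ, hδ, H⟩ := hP.exists_increment_bound hf hC (half_pos hε)
  refine ⟨δ, hδ, fun {s} hs hd => ?_⟩
  have hs' : t < s := hs
  rw [Real.dist_eq, abs_of_pos (by linarith)] at hd
  have hpos : 0 < s - t := by linarith
  have hh : ((s - t).toNNReal : ℝ) = s - t := Real.coe_toNNReal _ hpos.le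
  have e : t.toNNReal + (s - t).toNNReal = s.toNNReal := by
    rw [← Real.toNNReal_add ht hpos.le]; congr 1; ring
  have h1 := hP.abs_integral_add_sub_le hf hC hg hB
    (H (s - t).toNNReal (by simpa using hs') (by rw [hh]; exact hd)) t.toNNReal x
  rw [e, hh] at h1
  rw [Real.dist_eq, slope_def_field]
  have e2 : ((∫ y, f y ∂(P s.toNNReal x)) - ∫ y, f y ∂(P t.toNNReal x)) / (s - t)
      - ∫ y, G f y ∂(P t.toNNReal x)
      = ((∫ y, f y ∂(P s.toNNReal x)) - (∫ y, f y ∂(P t.toNNReal x))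
        - (s - t) * ∫ y, G f y ∂(P t.toNNReal x)) / (s - t) := by field_simp
  rw [e2, abs_div, abs_of_pos hpos, div_lt_iff₀ hpos]
  nlinarith

/-- Induction on `m` for all `f` at once: the right derivative of `P_t f - Q_t f` is `P_t (G f) -
Q_t (G f)`, and `G f` is bounded by `M * C`. So the bound of order `m` for `G f` integrates to the
bound of order `m + 1` for `f`. -/
theorem IsProcessGeneratedBy.abs_integral_sub_le {M : ℝ}
    (hG : IsBoundedOperator G M)
    (hP : IsProcessGeneratedBy G P) (hQ : IsProcessGeneratedBy G Q) (x : S) (m : ℕ) :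
    ∀ (f : S → ℝ) (_ : Measurable f) (C : ℝ) (_ : ∀ x, |f x| ≤ C) (t : ℝ) (_ : 0 ≤ t),
    |(∫ y, f y ∂(P t.toNNReal x)) - ∫ y, f y ∂(Q t.toNNReal x)|
      ≤ 2 * C * ((M * t) ^ m / m.factorial) := by
  have := hP.isMarkov
  have := hQ.isMarkov
  induction m with
  | zero =>
    intro f hf C hC t ht
    have h1 : |∫ y, f y ∂(P t.toNNReal x)| ≤ C := abs_integral_le_of_bounded hC
    have h2 : |∫ y, f y ∂(Q t.toNNReal x)| ≤ C := abs_integral_le_of_bounded hC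
    rw [abs_le] at *
    constructor <;> simp <;> linarith
  | succ m ih =>
    intro f hf C hC t ht
    obtain ⟨hg, hB⟩ := hG f hf C hC
    have hB' : ∀ s : ℝ, HasDerivAt (fun s : ℝ => 2 * C * ((M * s) ^ (m + 1) / (m + 1).factorial))
        (2 * (M * C) * ((M * s) ^ m / m.factorial)) s := by
      intro s
      have := ((((hasDerivAt_id s).const_mul M).pow (m + 1)).div_const
        ((m + 1).factorial : ℝ)).const_mul (2 * C)
      convert! this using 1
      simp only [Nat.factorial_succ, id]
      push_cast
      have : (m.factorial : ℝ) ≠ 0 := by positivity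
      field_simp
    have := image_norm_le_of_norm_deriv_right_le_deriv_boundary
      (f := fun t : ℝ => (∫ y, f y ∂(P t.toNNReal x)) - ∫ y, f y ∂(Q t.toNNReal x))
      (f' := fun t : ℝ => (∫ y, G f y ∂(P t.toNNReal x)) - ∫ y, G f y ∂(Q t.toNNReal x))
      (a := 0) (b := t)
      ((hP.continuous_integral hG hf hC x).sub (hQ.continuous_integral hG hf hC x)).continuousOn
      (fun s hs => (hP.hasDerivWithinAt_integral hG hf hC x hs.1).sub
        (hQ.hasDerivWithinAt_integral hG hf hC x hs.1))
      (by simp [hP.zero, hQ.zero]) hB'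
      (fun s hs => ih (G f) hg (M * C) hB s hs.1)
    exact this ⟨ht, le_rfl⟩

theorem IsProcessGeneratedBy.unique {M : ℝ} (hG : IsBoundedOperator G M)
    (hP : IsProcessGeneratedBy G P) (hQ : IsProcessGeneratedBy G Q) : P = Q := by
  have := hP.isMarkov
  have := hQ.isMarkov
  funext t
  ext x A hA
  have hf : Measurable (A.indicator (1 : S → ℝ)) := measurable_one.indicator hA
  have hC : ∀ y, |A.indicator (1 : S → ℝ) y| ≤ 1 := by
    intro y; by_cases hy : y ∈ A <;> simp [hy]
  have key : ∀ m : ℕ, |(∫ y, A.indicator (1 : S → ℝ) y ∂(P t x))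
      - ∫ y, A.indicator (1 : S → ℝ) y ∂(Q t x)| ≤ 2 * ((M * t) ^ m / m.factorial) := by
    intro m
    simpa using hP.abs_integral_sub_le hG hQ x m _ hf 1 hC t t.2
  have lim : Tendsto (fun m : ℕ => 2 * ((M * t) ^ m / m.factorial)) atTop (𝓝 0) := by
    simpa using (FloorSemiring.tendsto_pow_div_factorial_atTop (M * t : ℝ)).const_mul 2
  have := le_antisymm (ge_of_tendsto' lim key) (abs_nonneg _)
  rw [abs_eq_zero, sub_eq_zero, integral_indicator_one hA, integral_indicator_one hA] at this
  exact (measureReal_eq_measureReal_iff).1 this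

end Uniqueness

/-! ### Existence: the exponential series of a jump kernel of constant mass -/

section Semigroup

variable {S : Type*} [MeasurableSpace S] {K : Kernel S S} {c : ℝ≥0}

/-- The coefficient `e^{-ct} t^m / m!` of the exponential series. -/
def expWeight (c t : ℝ) (m : ℕ) : ℝ := Real.exp (-(c * t)) * (t ^ m / m.factorial)

theorem expWeight_nonneg (c : ℝ) {t : ℝ} (ht : 0 ≤ t) (m : ℕ) : 0 ≤ expWeight c t m := by
  unfold expWeight; positivity

/-- The kernel is not normalised: `K ^ m` has mass `c ^ m`, and multiplying by it turns the weights
into Poisson probabilities. -/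
theorem hasSum_expWeight (c t : ℝ) : HasSum (fun m => expWeight c t m * c ^ m) 1 := by
  have := (NormedSpace.expSeries_div_hasSum_exp (c * t)).mul_left (Real.exp (-(c * t)))
  rw [← Real.exp_eq_exp_ℝ, ← Real.exp_add, neg_add_cancel, Real.exp_zero] at this
  convert! this using 1
  funext m
  rw [expWeight, mul_pow]; ring

theorem expWeight_add (c s t : ℝ) (n : ℕ) : expWeight c (s + t) n
    = ∑ p ∈ Finset.HasAntidiagonal.antidiagonal n, expWeight c s p.1 * expWeight c t p.2 := by
  have : Real.exp (-(c * (s + t))) = Real.exp (-(c * s)) * Real.exp (-(c * t)) := by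
    rw [← Real.exp_add]; congr 1; ring
  rw [expWeight, this, (Commute.all s t).add_pow', Finset.sum_div, Finset.mul_sum]
  refine Finset.sum_congr rfl fun p hp => ?_
  rw [Finset.HasAntidiagonal.mem_antidiagonal] at hp
  subst hp
  have h := Nat.choose_mul_factorial_mul_factorial (Nat.le_add_right p.1 p.2)
  rw [Nat.add_sub_cancel_left] at h
  have h' : ((p.1 + p.2).choose p.1 : ℝ) * p.1.factorial * p.2.factorial
    = (p.1 + p.2).factorial := by exact_mod_cast h
  rw [← h', expWeight, expWeight, nsmul_eq_mul]
  have h1 : ((p.1 + p.2).choose p.1 : ℝ) ≠ 0 := by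
    exact_mod_cast (Nat.choose_pos (Nat.le_add_right _ _)).ne'
  field_simp

theorem abs_exp_neg_sub_le {y : ℝ} (hy : 0 ≤ y) : |Real.exp (-y) - 1 + y| ≤ y ^ 2 := by
  have h1 := Real.one_sub_le_exp_neg y
  have h2 : Real.exp (-y) ≤ 1 - y + y ^ 2 := by
    rw [Real.exp_neg]
    -- Since `(1 + y) (1 - y + y²) = 1 + y³ ≥ 1`, the inverse of `1 - y + y²` is at most `1 + y ≤
    -- e^y`.
    refine inv_le_of_inv_le₀ (by nlinarith [sq_nonneg (y - 1)]) ?_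
    refine le_trans ?_ (Real.add_one_le_exp y)
    rw [inv_le_iff_one_le_mul₀ (by nlinarith [sq_nonneg (y - 1)])]
    nlinarith [pow_nonneg hy 3]
  rw [abs_le]; constructor <;> linarith

/-- The semigroup `e^{-ct} ∑ t^m K^m / m!` with jump kernel `K` of total mass `c`. -/
def jumpSemigroup (K : Kernel S S) (c t : ℝ≥0) : Kernel S S where
  toFun x := Measure.sum fun m : ℕ => ENNReal.ofReal (expWeight c t m) • (K ^ m) x
  measurable' := by
    refine Measure.measurable_of_measurable_coe _ fun A hA => ?_
    simp only [Measure.sum_apply _ hA, Measure.smul_apply, smul_eq_mul]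
    exact Measurable.tsum fun m => ((K ^ m).measurable_coe hA).const_mul _

theorem jumpSemigroup_apply (t : ℝ≥0) (x : S) : jumpSemigroup K c t x
    = Measure.sum fun m : ℕ => ENNReal.ofReal (expWeight c t m) • (K ^ m) x := rfl

theorem lintegral_jumpSemigroup (t : ℝ≥0) (x : S) (g : S → ℝ≥0∞) :
    ∫⁻ y, g y ∂(jumpSemigroup K c t x)
      = ∑' m : ℕ, ENNReal.ofReal (expWeight c t m) * ∫⁻ y, g y ∂((K ^ m) x) := by
  simp [jumpSemigroup_apply, lintegral_sum_measure, lintegral_smul_measure]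

/-- This form splits off the first jump and the primed one the last; the duality of powers uses one
for each process. -/
theorem Kernel.lintegral_pow_succ (m : ℕ) (x : S) {g : S → ℝ≥0∞} (hg : Measurable g) :
    ∫⁻ y, g y ∂((K ^ (m + 1)) x) = ∫⁻ z, ∫⁻ y, g y ∂((K ^ m) z) ∂(K x) := by
  rw [_root_.pow_succ]; exact Kernel.lintegral_comp _ _ _ hg

theorem Kernel.lintegral_pow_succ' (m : ℕ) (x : S) {g : S → ℝ≥0∞} (hg : Measurable g) :
    ∫⁻ y, g y ∂((K ^ (m + 1)) x) = ∫⁻ z, ∫⁻ y, g y ∂(K z) ∂((K ^ m) x) := by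
  rw [_root_.pow_succ']; exact Kernel.lintegral_comp _ _ _ hg

theorem Kernel.pow_zero_apply (x : S) : (K ^ 0) x = Measure.dirac x := by
  rw [pow_zero]; exact Kernel.id_apply x

theorem Kernel.pow_apply_univ (hK : ∀ x, K x Set.univ = c) (m : ℕ) (x : S) :
    (K ^ m) x Set.univ = (c : ℝ≥0∞) ^ m := by
  induction m generalizing x with
  | zero => rw [Kernel.pow_zero_apply]; simp
  | succ m ih =>
    have := Kernel.lintegral_pow_succ (K := K) m x (g := 1) measurable_one
    simp only [Pi.one_apply, lintegral_one] at this
    rw [this]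
    simp [ih, hK, pow_succ]

theorem isMarkovKernel_jumpSemigroup (hK : ∀ x, K x Set.univ = c) (t : ℝ≥0) :
    IsMarkovKernel (jumpSemigroup K c t) := by
  refine ⟨fun x => ⟨?_⟩⟩
  have h := lintegral_jumpSemigroup (K := K) (c := c) t x 1
  simp only [Pi.one_apply, lintegral_one, Kernel.pow_apply_univ hK] at h
  rw [h]
  have e : ∀ m : ℕ, ENNReal.ofReal (expWeight c t m) * (c : ℝ≥0∞) ^ m
      = ENNReal.ofReal (expWeight c t m * c ^ m) := by
    intro m
    rw [ENNReal.ofReal_mul (expWeight_nonneg _ t.coe_nonneg _), ENNReal.ofReal_pow c.coe_nonneg,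
      ENNReal.ofReal_coe_nnreal]
  simp only [e]
  rw [← ENNReal.ofReal_tsum_of_nonneg
    (fun m => mul_nonneg (expWeight_nonneg _ t.coe_nonneg _) (by positivity)) (hasSum_expWeight c t).summable,
    (hasSum_expWeight c t).tsum_eq, ENNReal.ofReal_one]

theorem jumpSemigroup_zero : jumpSemigroup K c 0 = Kernel.id := by
  ext x A hA
  rw [jumpSemigroup_apply, Measure.sum_apply _ hA, tsum_eq_single 0]
  · rw [Kernel.pow_zero_apply, Kernel.id_apply]; simp [expWeight]
  · intro m hm
    simp [expWeight, hm]

/-- The Cauchy product of two exponential series. All terms lie in `ℝ≥0∞`, so the double sum may be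
rearranged along antidiagonals without summability conditions. -/
theorem jumpSemigroup_add (s t : ℝ≥0) :
    jumpSemigroup K c (s + t) = jumpSemigroup K c t ∘ₖ jumpSemigroup K c s := by
  ext x A hA
  rw [Kernel.comp_apply' _ _ _ hA, lintegral_jumpSemigroup]
  have h1 : ∀ y (r : ℝ≥0), jumpSemigroup K c r y A
      = ∑' m : ℕ, ENNReal.ofReal (expWeight c r m) * (K ^ m) y A := by
    intro y r
    simp [jumpSemigroup_apply, Measure.sum_apply _ hA]
  simp only [h1]
  have h2 : ∀ i : ℕ, ENNReal.ofReal (expWeight c s i) *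
      ∫⁻ y, ∑' m : ℕ, ENNReal.ofReal (expWeight c t m) * (K ^ m) y A ∂((K ^ i) x)
      = ∑' j : ℕ, ENNReal.ofReal (expWeight c s i * expWeight c t j) * (K ^ (i + j)) x A := by
    intro i
    rw [lintegral_tsum fun j => (((K ^ j).measurable_coe hA).const_mul _).aemeasurable,
      ← ENNReal.tsum_mul_left]
    refine tsum_congr fun j => ?_
    rw [lintegral_const_mul _ ((K ^ j).measurable_coe hA), Kernel.pow_add_apply_eq_lintegral _ _ _ _ hA,
      ENNReal.ofReal_mul (expWeight_nonneg _ s.coe_nonneg _), mul_assoc]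
  simp only [h2]
  rw [← ENNReal.tsum_prod, ← Finset.HasAntidiagonal.sigmaAntidiagonalEquivProd.tsum_eq, ENNReal.tsum_sigma']
  refine tsum_congr fun n => ?_
  rw [NNReal.coe_add, expWeight_add, ENNReal.ofReal_sum_of_nonneg, Finset.sum_mul, tsum_fintype,
    ← Finset.sum_coe_sort]
  · refine Finset.sum_congr rfl fun p _ => ?_
    have := Finset.HasAntidiagonal.mem_antidiagonal.1 p.2
    simp [this]
  · intro p _
    exact mul_nonneg (expWeight_nonneg _ s.coe_nonneg _) (expWeight_nonneg _ t.coe_nonneg _)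

theorem abs_integral_pow_le (hK : ∀ x, K x Set.univ = c) {f : S → ℝ} {C : ℝ}
    (hC : ∀ x, |f x| ≤ C) (m : ℕ) (x : S) : |∫ y, f y ∂((K ^ m) x)| ≤ C * c ^ m := by
  have : IsFiniteMeasure ((K ^ m) x) :=
    ⟨by rw [Kernel.pow_apply_univ hK]; exact ENNReal.pow_lt_top ENNReal.coe_lt_top⟩
  have := norm_integral_le_of_norm_le_const (μ := (K ^ m) x) (f := f) (ae_of_all _ hC)
  simpa [measureReal_def, Kernel.pow_apply_univ hK] using this

theorem hasSum_integral_jumpSemigroup (hK : ∀ x, K x Set.univ = c) {f : S → ℝ}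
    (hf : Measurable f) {C : ℝ} (hC : ∀ x, |f x| ≤ C) (t : ℝ≥0) (x : S) :
    HasSum (fun m => expWeight c t m * ∫ y, f y ∂((K ^ m) x))
      (∫ y, f y ∂(jumpSemigroup K c t x)) := by
  have := isMarkovKernel_jumpSemigroup hK t
  have h : Integrable f (jumpSemigroup K c t x) := integrable_of_bounded hf hC
  rw [jumpSemigroup_apply] at h ⊢
  have := hasSum_integral_measure h
  simpa only [integral_smul_measure, ENNReal.toReal_ofReal (expWeight_nonneg _ t.coe_nonneg _),
    smul_eq_mul] using this

/-- Three errors, each at most `C (c h)²`: the terms with at least two jumps, the replacement of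
`e^{-ch}` by `1 - ch` in the term without jump, and its replacement by `1` in the term with one
jump. -/
theorem abs_integral_jumpSemigroup_sub_le (hK : ∀ x, K x Set.univ = c) {f : S → ℝ}
    (hf : Measurable f) {C : ℝ} (hC : ∀ x, |f x| ≤ C) (h : ℝ≥0) (x : S) :
    |(∫ y, f y ∂(jumpSemigroup K c h x)) - f x - h * ((∫ y, f y ∂(K x)) - c * f x)|
      ≤ 3 * C * (c * h) ^ 2 := by
  have hc : (0 : ℝ) ≤ c := c.coe_nonneg
  have hh : (0 : ℝ) ≤ h := h.coe_nonneg
  have hC0 : 0 ≤ C := (abs_nonneg _).trans (hC x)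
  have s1 := (hasSum_nat_add_iff' 2).2 (hasSum_integral_jumpSemigroup hK hf hC h x)
  have s2 := ((hasSum_nat_add_iff' 2).2 (hasSum_expWeight c h)).mul_left C
  have R := s1.norm_le_of_bounded s2 fun m => by
    rw [norm_mul, Real.norm_of_nonneg (expWeight_nonneg _ h.coe_nonneg _), mul_left_comm]
    exact mul_le_mul_of_nonneg_left (abs_integral_pow_le hK hC _ x) (expWeight_nonneg _ h.coe_nonneg _)
  have a0 : ∫ y, f y ∂((K ^ 0) x) = f x := by
    rw [Kernel.pow_zero_apply, integral_dirac' _ _ hf.stronglyMeasurable]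
  have a1 : |∫ y, f y ∂(K x)| ≤ C * c := by simpa using abs_integral_pow_le hK hC 1 x
  simp only [Finset.sum_range_succ, Finset.sum_range_zero, a0] at R
  simp only [pow_one, zero_add, pow_zero,
    mul_one, expWeight, Nat.factorial_zero, Nat.factorial_one, Nat.cast_one, div_one,
    Real.norm_eq_abs] at R
  have hy : 0 ≤ (c * h : ℝ) := by positivity
  -- With `y = c h`, this is `e^{-y} (1 + y) ≥ (1 - y) (1 + y) = 1 - y²`.
  have e2 : C * (1 - (Real.exp (-(c * h)) + Real.exp (-(c * h)) * h * c)) ≤ C * (c * h) ^ 2 := by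
    gcongr
    nlinarith [Real.one_sub_le_exp_neg (c * h : ℝ)]
  have e3 : |(Real.exp (-(c * h)) - 1 + c * h) * f x| ≤ (c * h) ^ 2 * C := by
    rw [abs_mul]
    exact mul_le_mul (abs_exp_neg_sub_le hy) (hC x) (abs_nonneg _) (by positivity)
  have e4 : |h * (Real.exp (-(c * h)) - 1) * ∫ y, f y ∂(K x)| ≤ h * (c * h) * (C * c) := by
    rw [abs_mul, abs_mul, abs_of_nonneg hh]
    gcongr
    rw [abs_le]
    constructor
    · linarith [Real.one_sub_le_exp_neg (c * h : ℝ)]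
    · have : Real.exp (-(c * h)) ≤ 1 := Real.exp_le_one_iff.2 (by linarith)
      linarith
  have e : (∫ y, f y ∂(jumpSemigroup K c h x)) - f x - h * ((∫ y, f y ∂(K x)) - c * f x)
      = ((∫ y, f y ∂(jumpSemigroup K c h x)) - (Real.exp (-(c * h)) * f x
          + Real.exp (-(c * h)) * h * ∫ y, f y ∂(K x)))
        + (Real.exp (-(c * h)) - 1 + c * h) * f x
        + h * (Real.exp (-(c * h)) - 1) * ∫ y, f y ∂(K x) := by ring
  rw [e]
  refine (abs_add_three _ _ _).trans ?_
  nlinarith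

/-- `G` acts on bounded measurable functions as the generator of the jump process with jump
kernel `K` of total mass `c`. -/
def IsJumpGenerator (G : (S → ℝ) → S → ℝ) (K : Kernel S S) (c : ℝ≥0) : Prop :=
  ∀ f : S → ℝ, Measurable f → (∃ C : ℝ, ∀ x, |f x| ≤ C) →
    ∀ x, G f x = (∫ y, f y ∂(K x)) - c * f x

variable {G : (S → ℝ) → S → ℝ}

theorem IsJumpGenerator.isBoundedOperator (hK : ∀ x, K x Set.univ = c)
    (hG : IsJumpGenerator G K c) : IsBoundedOperator G (2 * c) := by
  intro f hf C hC
  have hfin : IsFiniteKernel K := ⟨⟨c, ENNReal.coe_lt_top, fun x => (hK x).le⟩⟩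
  have e : G f = fun x => (∫ y, f y ∂(K x)) - c * f x := funext (hG f hf ⟨C, hC⟩)
  rw [e]
  refine ⟨(hf.stronglyMeasurable.integral_kernel (κ := K)).measurable.sub (hf.const_mul _), ?_⟩
  intro x
  have a1 : |∫ y, f y ∂(K x)| ≤ C * c := by simpa using abs_integral_pow_le hK hC 1 x
  have a2 : |c * f x| ≤ c * C := by
    rw [abs_mul, abs_of_nonneg c.coe_nonneg]
    exact mul_le_mul_of_nonneg_left (hC x) c.coe_nonneg
  exact (abs_sub _ _).trans (by linarith)

theorem IsJumpGenerator.isProcessGeneratedBy (hK : ∀ x, K x Set.univ = c)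
    (hG : IsJumpGenerator G K c) : IsProcessGeneratedBy G (jumpSemigroup K c) where
  isMarkov := isMarkovKernel_jumpSemigroup hK
  zero := jumpSemigroup_zero
  chapman_kolmogorov := jumpSemigroup_add
  generator := by
    rintro f hf ⟨C, hC⟩
    -- A point of `S` is needed to know that the bound `C` is nonnegative.
    rcases isEmpty_or_nonempty S with hS | ⟨⟨x₀⟩⟩
    · exact Metric.tendstoUniformly_iff.2 fun ε _ => Eventually.of_forall fun _ x => hS.elim x
    have hC0 : 0 ≤ C := (abs_nonneg _).trans (hC x₀)
    rw [Metric.tendstoUniformly_iff]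
    intro ε hε
    have lim : Tendsto (fun h : ℝ≥0 => 3 * C * c ^ 2 * (h : ℝ)) (𝓝[>] 0) (𝓝 0) := by
      have : Continuous fun h : ℝ≥0 => 3 * C * (c : ℝ) ^ 2 * (h : ℝ) := by fun_prop
      have := (this.tendsto 0).mono_left (nhdsWithin_le_nhds (s := Set.Ioi 0))
      simpa using this
    filter_upwards [lim.eventually_lt_const hε, self_mem_nhdsWithin] with h hlt hpos x
    have h0 : (0 : ℝ) < h := hpos
    rw [dist_comm, Real.dist_eq, hG f hf ⟨C, hC⟩]
    have e : ((∫ y, f y ∂(jumpSemigroup K c h x)) - f x) / h - ((∫ y, f y ∂(K x)) - c * f x)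
        = ((∫ y, f y ∂(jumpSemigroup K c h x)) - f x - h * ((∫ y, f y ∂(K x)) - c * f x)) / h := by
      field_simp
    rw [e, abs_div, abs_of_pos h0, div_lt_iff₀ h0]
    refine (abs_integral_jumpSemigroup_sub_le hK hf hC h x).trans_lt ?_
    nlinarith

theorem IsJumpGenerator.eq_jumpSemigroup (hK : ∀ x, K x Set.univ = c)
    (hG : IsJumpGenerator G K c) {P : ℝ≥0 → Kernel S S} (hP : IsProcessGeneratedBy G P) :
    P = jumpSemigroup K c :=
  hP.unique (hG.isBoundedOperator hK) (hG.isProcessGeneratedBy hK)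

theorem IsJumpGenerator.existsUnique (hK : ∀ x, K x Set.univ = c)
    (hG : IsJumpGenerator G K c) : ∃! P : ℝ≥0 → Kernel S S, IsProcessGeneratedBy G P :=
  ⟨_, hG.isProcessGeneratedBy hK, fun _ hP => hG.eq_jumpSemigroup hK hP⟩

end Semigroup

/-! ### From duality of one jump to duality of the processes -/

section Duality

variable {S S' : Type*} [MeasurableSpace S] [MeasurableSpace S'] {K : Kernel S S}
  {K' : Kernel S' S'} {c : ℝ≥0}

/-- Split off the first jump of one process and the last jump of the other. The induction hypothesis
and one-jump duality turn both sides into the integral of `D` against `K x` and `(K' ^ m) y`, in the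
two orders; Tonelli exchanges them. -/
theorem lintegral_pow_dual (hK : ∀ x, K x Set.univ = c) (hK' : ∀ y, K' y Set.univ = c)
    {D : S → S' → ℝ≥0∞} (hD : Measurable (Function.uncurry D))
    (hdual : ∀ x y, ∫⁻ x', D x' y ∂(K x) = ∫⁻ y', D x y' ∂(K' y)) (m : ℕ) (x : S) (y : S') :
    ∫⁻ x', D x' y ∂((K ^ m) x) = ∫⁻ y', D x y' ∂((K' ^ m) y) := by
  have hx : ∀ y, Measurable fun x => D x y := fun y => hD.comp measurable_prodMk_right
  have hy : ∀ x, Measurable fun y => D x y := fun x => hD.comp measurable_prodMk_left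
  induction m generalizing x y with
  | zero => rw [Kernel.pow_zero_apply, Kernel.pow_zero_apply, lintegral_dirac' _ (hx y),
      lintegral_dirac' _ (hy x)]
  | succ m ih =>
    have f1 : IsFiniteMeasure (K x) := ⟨by simp [hK]⟩
    have f2 : IsFiniteMeasure ((K' ^ m) y) :=
      ⟨by rw [Kernel.pow_apply_univ hK']; exact ENNReal.pow_lt_top ENNReal.coe_lt_top⟩
    rw [Kernel.lintegral_pow_succ _ _ (hx y), Kernel.lintegral_pow_succ' _ _ (hy x)]
    simp only [ih, ← hdual]
    exact lintegral_lintegral_swap hD.aemeasurable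

theorem pow_apply_level_eq_zero {N : S' → ℕ} (hN : Measurable N)
    (hcons : ∀ y, ∀ᵐ y' ∂(K' y), N y' = N y) (m : ℕ) (y : S') :
    ∀ᵐ y' ∂((K' ^ m) y), N y' = N y := by
  have hm : ∀ y, MeasurableSet {y' | N y' = N y} := fun y => hN (measurableSet_singleton (N y))
  induction m generalizing y with
  | zero => rw [Kernel.pow_zero_apply, ae_dirac_iff (hm y)]
  | succ m ih =>
    rw [_root_.pow_succ]
    refine Kernel.ae_comp_of_ae_ae (hm y) ?_
    filter_upwards [hcons y] with z hz
    simpa only [hz] using ih z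

/-- The level function `N` serves only for integrability: the dual process stays on a level of `N`,
where `D x` is bounded. The equality of extended integrals then transfers finiteness to the other
process. -/
theorem generateDualProcesses_of_jump {G : (S → ℝ) → S → ℝ} {G' : (S' → ℝ) → S' → ℝ}
    (hK : ∀ x, K x Set.univ = c) (hK' : ∀ y, K' y Set.univ = c)
    (hG : IsJumpGenerator G K c) (hG' : IsJumpGenerator G' K' c)
    {D : S → S' → ℝ} (hD : Measurable (Function.uncurry D)) (hD0 : ∀ x y, 0 ≤ D x y)
    (hdual : ∀ x y, ∫⁻ x', ENNReal.ofReal (D x' y) ∂(K x)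
      = ∫⁻ y', ENNReal.ofReal (D x y') ∂(K' y))
    {N : S' → ℕ} (hN : Measurable N) (hcons : ∀ y, ∀ᵐ y' ∂(K' y), N y' = N y)
    (hbdd : ∀ x M, ∃ C, ∀ y, N y = M → D x y ≤ C) :
    GenerateDualProcesses G G' D where
  process := hG.existsUnique hK
  dualProcess := hG'.existsUnique hK'
  duality := by
    intro P Q hP hQ t x y
    rw [hG.eq_jumpSemigroup hK hP, hG'.eq_jumpSemigroup hK' hQ]
    have mk := isMarkovKernel_jumpSemigroup hK' t
    have hx : Measurable fun x => D x y := hD.comp measurable_prodMk_right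
    have hy : Measurable fun y => D x y := hD.comp measurable_prodMk_left
    have e : ∫⁻ x', ENNReal.ofReal (D x' y) ∂(jumpSemigroup K c t x)
        = ∫⁻ y', ENNReal.ofReal (D x y') ∂(jumpSemigroup K' c t y) := by
      rw [lintegral_jumpSemigroup, lintegral_jumpSemigroup]
      refine tsum_congr fun m => ?_
      rw [lintegral_pow_dual hK hK' (D := fun x y => ENNReal.ofReal (D x y)) hD.ennreal_ofReal hdual]
    have hlevel : ∀ᵐ y' ∂(jumpSemigroup K' c t y), N y' = N y := by
      rw [jumpSemigroup_apply, Measure.ae_sum_iff]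
      exact fun m => Measure.ae_smul_measure (pow_apply_level_eq_zero hN hcons m y) _
    obtain ⟨C, hC⟩ := hbdd x (N y)
    have iy : Integrable (fun y' => D x y') (jumpSemigroup K' c t y) := by
      refine Integrable.of_bound hy.aestronglyMeasurable C ?_
      filter_upwards [hlevel] with y' h
      rw [Real.norm_of_nonneg (hD0 x y')]
      exact hC y' h
    have ix : Integrable (fun x' => D x' y) (jumpSemigroup K c t x) := by
      refine ⟨hx.aestronglyMeasurable, ?_⟩
      rw [hasFiniteIntegral_iff_ofReal (ae_of_all _ fun x' => hD0 x' y), e]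
      exact (hasFiniteIntegral_iff_ofReal (ae_of_all _ fun y' => hD0 x y')).1 iy.2
    refine ⟨ix, iy, ?_⟩
    rw [integral_eq_lintegral_of_nonneg_ae (ae_of_all _ fun x' => hD0 x' y) ix.1,
      integral_eq_lintegral_of_nonneg_ae (ae_of_all _ fun y' => hD0 x y') iy.1, e]

end Duality

/-! ### Products and sums over sites after a change at one site or one bond -/

section Products

variable {n : ℕ} {S S' : Type}

/-- Both configurations are updated at once, so that a change of only one of them is the case where
the other keeps its value. The bond version below has the same form for the same reason. -/
theorem prod_update_site (d : S → S' → ℝ) (η : Config n S) (ξ : Config n S') (i : Fin (n + 1))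
    (r : S) (m : S') : ∏ j, d (Function.update η i r j) (Function.update ξ i m j)
      = d r m * ∏ j ∈ Finset.univ.erase i, d (η j) (ξ j) := by
  rw [← Finset.mul_prod_erase _ _ (Finset.mem_univ i)]
  simp only [Function.update_self]
  congr 1
  refine Finset.prod_congr rfl fun j hj => ?_
  rw [Function.update_of_ne (Finset.ne_of_mem_erase hj),
    Function.update_of_ne (Finset.ne_of_mem_erase hj)]

theorem setBond_castSucc (η : Config n S) (i : Fin n) (r s : S) :
    setBond η i r s i.castSucc = r := by
  rw [setBond, Function.update_of_ne Fin.castSucc_lt_succ.ne, Function.update_self]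

theorem setBond_succ (η : Config n S) (i : Fin n) (r s : S) : setBond η i r s i.succ = s := by
  rw [setBond, Function.update_self]

theorem setBond_of_ne (η : Config n S) (i : Fin n) (r s : S) {j : Fin (n + 1)}
    (h1 : j ≠ i.castSucc) (h2 : j ≠ i.succ) : setBond η i r s j = η j := by
  rw [setBond, Function.update_of_ne h2, Function.update_of_ne h1]

theorem setBond_self (η : Config n S) (i : Fin n) :
    setBond η i (η i.castSucc) (η i.succ) = η := by
  rw [setBond, Function.update_eq_self, Function.update_eq_self]

theorem prod_setBond (d : S → S' → ℝ) (η : Config n S) (ξ : Config n S') (i : Fin n)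
    (r s : S) (m l : S') : ∏ j, d (setBond η i r s j) (setBond ξ i m l j)
      = d r m * d s l * ∏ j ∈ (Finset.univ.erase i.castSucc).erase i.succ, d (η j) (ξ j) := by
  have h : i.succ ∈ Finset.univ.erase i.castSucc :=
    Finset.mem_erase.2 ⟨Fin.castSucc_lt_succ.ne', Finset.mem_univ _⟩
  rw [← Finset.mul_prod_erase _ _ (Finset.mem_univ i.castSucc), ← Finset.mul_prod_erase _ _ h,
    setBond_castSucc, setBond_castSucc, setBond_succ, setBond_succ, mul_assoc]
  congr 2
  refine Finset.prod_congr rfl fun j hj => ?_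
  have h2 := Finset.ne_of_mem_erase hj
  have h1 := Finset.ne_of_mem_erase (Finset.mem_of_mem_erase hj)
  rw [setBond_of_ne _ _ _ _ h1 h2, setBond_of_ne _ _ _ _ h1 h2]

/-- Stated with the old and new values on opposite sides to avoid truncated subtraction. -/
theorem sum_update_site (v : S → ℕ) (ξ : Config n S) (i : Fin (n + 1)) (m : S) :
    v (ξ i) + ∑ j, v (Function.update ξ i m j) = v m + ∑ j, v (ξ j) := by
  rw [← Finset.add_sum_erase _ _ (Finset.mem_univ i),
    ← Finset.add_sum_erase _ (fun j => v (ξ j)) (Finset.mem_univ i), Function.update_self]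
  have : ∑ j ∈ Finset.univ.erase i, v (Function.update ξ i m j)
      = ∑ j ∈ Finset.univ.erase i, v (ξ j) :=
    Finset.sum_congr rfl fun j hj => by rw [Function.update_of_ne (Finset.ne_of_mem_erase hj)]
  rw [this]; ring

theorem sum_setBond (v : S → ℕ) (ξ : Config n S) (i : Fin n) {m l : S}
    (h : v m + v l = v (ξ i.castSucc) + v (ξ i.succ)) :
    ∑ j, v (setBond ξ i m l j) = ∑ j, v (ξ j) := by
  have h1 := sum_update_site v ξ i.castSucc m
  have h2 := sum_update_site v (Function.update ξ i.castSucc m) i.succ l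
  rw [Function.update_of_ne Fin.castSucc_lt_succ.ne'] at h2
  simp only [setBond]
  omega

end Products

/-! ### Jump kernel of a chain with reservoirs -/

section Kernels

variable {n : ℕ} {S S' : Type} [MeasurableSpace S] [MeasurableSpace S']

@[fun_prop]
theorem measurable_setBond (i : Fin n) :
    Measurable fun p : Config n S × S × S => setBond p.1 i p.2.1 p.2.2 := by
  refine measurable_pi_lambda _ fun j => ?_
  by_cases h2 : j = i.succ
  · subst h2; simp only [setBond_succ]; fun_prop
  by_cases h1 : j = i.castSucc
  · subst h1; simp only [setBond_castSucc]; fun_prop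
  simp only [setBond_of_ne _ _ _ _ h1 h2]
  fun_prop

theorem measurable_update_pair (i : Fin (n + 1)) :
    Measurable fun p : Config n S × S => Function.update p.1 i p.2 := by
  refine measurable_pi_lambda _ fun j => ?_
  by_cases h : j = i
  · subst h; simp only [Function.update_self]; fun_prop
  simp only [Function.update_of_ne h]
  fun_prop

/-- The kernel that replaces the value at site `i` by a random value with law `μ`. -/
def siteKernel (i : Fin (n + 1)) (μ : Measure S) : Kernel (Config n S) (Config n S) :=
  (Kernel.id ×ₖ Kernel.const _ μ).map fun p => Function.update p.1 i p.2

theorem siteKernel_apply (i : Fin (n + 1)) (μ : Measure S) [IsProbabilityMeasure μ]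
    (η : Config n S) : siteKernel i μ η = μ.map (Function.update η i) := by
  rw [siteKernel, Kernel.map_apply _ (measurable_update_pair i), Kernel.prod_apply,
    Kernel.id_apply, Kernel.const_apply, Measure.dirac_prod,
    Measure.map_map (measurable_update_pair i) measurable_prodMk_left]
  rfl

/-- The kernel that replaces the values on the bond `i` according to `β`. -/
def bondKernel (i : Fin n) (β : Kernel (S × S) (S × S)) : Kernel (Config n S) (Config n S) :=
  (Kernel.id ×ₖ β.comap (fun η : Config n S => (η i.castSucc, η i.succ)) (by fun_prop)).map
    fun p => setBond p.1 i p.2.1 p.2.2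

theorem bondKernel_apply (i : Fin n) (β : Kernel (S × S) (S × S)) [IsMarkovKernel β]
    (η : Config n S) : bondKernel i β η
      = (β (η i.castSucc, η i.succ)).map fun q => setBond η i q.1 q.2 := by
  rw [bondKernel, Kernel.map_apply _ (measurable_setBond i), Kernel.prod_apply,
    Kernel.id_apply, Kernel.comap_apply, Measure.dirac_prod,
    Measure.map_map (measurable_setBond i) measurable_prodMk_left]
  rfl

/-- The jump kernel of a chain with reservoir laws `μa`, `μb` and bond redistribution `β`. -/
def chainKernel (n : ℕ) (μa μb : Measure S) (β : Kernel (S × S) (S × S)) :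
    Kernel (Config n S) (Config n S) :=
  siteKernel 0 μa + ∑ i : Fin n, bondKernel i β + siteKernel (Fin.last n) μb

variable (μa μb : Measure S) [IsProbabilityMeasure μa] [IsProbabilityMeasure μb]
  (β : Kernel (S × S) (S × S)) [IsMarkovKernel β]

theorem chainKernel_apply (η : Config n S) : chainKernel n μa μb β η
    = μa.map (Function.update η 0)
      + ∑ i : Fin n, (β (η i.castSucc, η i.succ)).map (fun q => setBond η i q.1 q.2)
      + μb.map (Function.update η (Fin.last n)) := by
  rw [chainKernel, add_apply, add_apply, sum_apply]
  simp only [siteKernel_apply, bondKernel_apply]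

theorem measurable_setBond_right (η : Config n S) (i : Fin n) :
    Measurable fun q : S × S => setBond η i q.1 q.2 :=
  (measurable_setBond i).comp measurable_prodMk_left

theorem chainKernel_apply_univ (η : Config n S) :
    chainKernel n μa μb β η Set.univ = ((n + 2 : ℕ) : ℝ≥0) := by
  rw [chainKernel_apply]
  simp only [Measure.add_apply, Measure.finsetSum_apply]
  have h : ∀ i : Fin n,
      ((β (η i.castSucc, η i.succ)).map fun q => setBond η i q.1 q.2) Set.univ = 1 := fun i => by
    rw [Measure.map_apply (measurable_setBond_right η i) MeasurableSet.univ]; simp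
  simp only [h]
  rw [Measure.map_apply (measurable_update η) MeasurableSet.univ,
    Measure.map_apply (measurable_update η) MeasurableSet.univ]
  simp only [Set.preimage_univ, measure_univ, Finset.sum_const, Finset.card_univ, Fintype.card_fin,
    nsmul_eq_mul, mul_one]
  push_cast
  ring

theorem lintegral_chainKernel (η : Config n S) {g : Config n S → ℝ≥0∞} (hg : Measurable g) :
    ∫⁻ y, g y ∂(chainKernel n μa μb β η) = ∫⁻ r, g (Function.update η 0 r) ∂μa
      + ∑ i : Fin n, ∫⁻ q, g (setBond η i q.1 q.2) ∂(β (η i.castSucc, η i.succ))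
      + ∫⁻ r, g (Function.update η (Fin.last n) r) ∂μb := by
  rw [chainKernel_apply, lintegral_add_measure, lintegral_add_measure,
    lintegral_finsetSum_measure, lintegral_map hg (measurable_update η),
    lintegral_map hg (measurable_update η)]
  simp only [lintegral_map hg (measurable_setBond_right η _)]

theorem integral_chainKernel (η : Config n S) {f : Config n S → ℝ} (hf : Measurable f)
    {C : ℝ} (hC : ∀ x, |f x| ≤ C) :
    ∫ y, f y ∂(chainKernel n μa μb β η) = ∫ r, f (Function.update η 0 r) ∂μa
      + ∑ i : Fin n, ∫ q, f (setBond η i q.1 q.2) ∂(β (η i.castSucc, η i.succ))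
      + ∫ r, f (Function.update η (Fin.last n) r) ∂μb := by
  have hint : ∀ (μ : Measure (Config n S)) [IsFiniteMeasure μ], Integrable f μ :=
    fun μ _ => integrable_of_bounded hf hC
  rw [chainKernel_apply, integral_add_measure, integral_add_measure (hint _),
    integral_finsetSum_measure fun i _ => hint _,
    integral_map (measurable_update η).aemeasurable hf.aestronglyMeasurable,
    integral_map (measurable_update η).aemeasurable hf.aestronglyMeasurable]
  · simp only [integral_map (measurable_setBond_right η _).aemeasurable hf.aestronglyMeasurable]
  · exact integrable_finsetSum_measure.2 fun i _ => hint _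
  · exact (hint _).add_measure (integrable_finsetSum_measure.2 fun i _ => hint _)
  · exact hint _

/-- Every one of the `n + 2` moves has a probability law, so its term `- f η` integrates to itself
and the total loss is `(n + 2) f η`. -/
theorem isJumpGenerator_chainKernel {G : (Config n S → ℝ) → Config n S → ℝ}
    (hG : ∀ f : Config n S → ℝ, Measurable f → (∃ C : ℝ, ∀ x, |f x| ≤ C) → ∀ η,
      G f η = ∫ r, (f (Function.update η 0 r) - f η) ∂μa
        + ∑ i : Fin n, ∫ q, (f (setBond η i q.1 q.2) - f η) ∂(β (η i.castSucc, η i.succ))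
        + ∫ r, (f (Function.update η (Fin.last n) r) - f η) ∂μb) :
    IsJumpGenerator G (chainKernel n μa μb β) (n + 2 : ℕ) := by
  rintro f hf ⟨C, hC⟩ η
  rw [hG f hf ⟨C, hC⟩, integral_chainKernel μa μb β η hf hC]
  have h1 : ∀ (i : Fin (n + 1)) (μ : Measure S) [IsProbabilityMeasure μ],
      ∫ r, (f (Function.update η i r) - f η) ∂μ = ∫ r, f (Function.update η i r) ∂μ - f η := by
    intro i μ _
    rw [integral_sub (f := fun r => f (Function.update η i r))
      (integrable_of_bounded (hf.comp (measurable_update η)) fun r => hC _) (integrable_const _)]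
    simp
  have h2 : ∀ i : Fin n, ∫ q, (f (setBond η i q.1 q.2) - f η) ∂(β (η i.castSucc, η i.succ))
      = ∫ q, f (setBond η i q.1 q.2) ∂(β (η i.castSucc, η i.succ)) - f η := by
    intro i
    rw [integral_sub (f := fun q : S × S => f (setBond η i q.1 q.2))
      (integrable_of_bounded (hf.comp (measurable_setBond_right η i)) fun r => hC _)
      (integrable_const _)]
    simp
  simp only [h1, h2, Finset.sum_sub_distrib, Finset.sum_const, Finset.card_univ, Fintype.card_fin,
    nsmul_eq_mul]
  push_cast
  ring

end Kernels

/-- The total number of particles of a dual configuration. -/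
def totalNumber {n : ℕ} {S : Type} (toNat : S → ℕ) (ξ : DualConfig n S) : ℕ :=
  ξ.1 + ∑ i, toNat (ξ.2.1 i) + ξ.2.2

/-- An injective `toNat` embeds the level set into a finite box. This makes any function of the dual
configuration bounded on a level. -/
theorem finite_totalNumber_eq {n : ℕ} {S : Type} {toNat : S → ℕ}
    (hinj : Function.Injective toNat) (M : ℕ) :
    {ξ : DualConfig n S | totalNumber toNat ξ = M}.Finite := by
  have hφ : Function.Injective
      (fun ξ : DualConfig n S => ((ξ.1, fun i => toNat (ξ.2.1 i), ξ.2.2) : DualConfig n ℕ)) := by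
    rintro ⟨a, ξ, b⟩ ⟨a', ξ', b'⟩ h
    simp only [Prod.mk.injEq] at h
    obtain ⟨rfl, h, rfl⟩ := h
    have : ξ = ξ' := funext fun i => hinj (congrFun h i)
    rw [this]
  refine (((Set.finite_Iic M).prod ((Set.Finite.pi' fun _ : Fin (n + 1) => Set.finite_Iic M).prod
    (Set.finite_Iic M))).preimage hφ.injOn).subset ?_
  intro ξ hξ
  have hξ' : ξ.1 + ∑ i, toNat (ξ.2.1 i) + ξ.2.2 = M := hξ
  refine ⟨?_, fun i => ?_, ?_⟩
  · show ξ.1 ≤ M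
    omega
  · show toNat (ξ.2.1 i) ≤ M
    have := Finset.single_le_sum (f := fun i => toNat (ξ.2.1 i)) (fun _ _ => Nat.zero_le _)
      (Finset.mem_univ i)
    omega
  · show ξ.2.2 ≤ M
    omega

/-! ### Jump kernel of the dual chain with absorbing ends -/

section DualKernel

variable {n : ℕ} {S : Type} [MeasurableSpace S] [Countable S] [MeasurableSingletonClass S] [Zero S]

/-- The jump kernel of a chain with absorbing boundary sites and bond redistribution `β`. -/
def dualChainKernel (n : ℕ) (toNat : S → ℕ) (β : S → S → Measure (S × S)) :
    Kernel (DualConfig n S) (DualConfig n S) :=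
  Kernel.ofFunOfCountable fun ξ =>
    Measure.dirac (ξ.1 + toNat (ξ.2.1 0), Function.update ξ.2.1 0 0, ξ.2.2)
    + ∑ i : Fin n, (β (ξ.2.1 i.castSucc) (ξ.2.1 i.succ)).map
        (fun q => (ξ.1, setBond ξ.2.1 i q.1 q.2, ξ.2.2))
    + Measure.dirac (ξ.1, Function.update ξ.2.1 (Fin.last n) 0,
        toNat (ξ.2.1 (Fin.last n)) + ξ.2.2)

variable (toNat : S → ℕ) (β : S → S → Measure (S × S))

theorem dualChainKernel_apply (ξ : DualConfig n S) : dualChainKernel n toNat β ξ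
    = Measure.dirac (ξ.1 + toNat (ξ.2.1 0), Function.update ξ.2.1 0 0, ξ.2.2)
    + ∑ i : Fin n, (β (ξ.2.1 i.castSucc) (ξ.2.1 i.succ)).map
        (fun q => (ξ.1, setBond ξ.2.1 i q.1 q.2, ξ.2.2))
    + Measure.dirac (ξ.1, Function.update ξ.2.1 (Fin.last n) 0,
        toNat (ξ.2.1 (Fin.last n)) + ξ.2.2) := rfl

theorem dualChainKernel_apply_univ [∀ m l, IsProbabilityMeasure (β m l)] (ξ : DualConfig n S) :
    dualChainKernel n toNat β ξ Set.univ = ((n + 2 : ℕ) : ℝ≥0) := by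
  rw [dualChainKernel_apply]
  simp only [Measure.add_apply, Measure.finsetSum_apply,
    Measure.map_apply (measurable_of_countable _) MeasurableSet.univ]
  simp only [Set.preimage_univ, measure_univ, Finset.sum_const, Finset.card_univ, Fintype.card_fin,
    nsmul_eq_mul, mul_one]
  push_cast
  ring

theorem lintegral_dualChainKernel (ξ : DualConfig n S) (g : DualConfig n S → ℝ≥0∞) :
    ∫⁻ y, g y ∂(dualChainKernel n toNat β ξ)
      = g (ξ.1 + toNat (ξ.2.1 0), Function.update ξ.2.1 0 0, ξ.2.2)
      + ∑ i : Fin n, ∫⁻ q, g (ξ.1, setBond ξ.2.1 i q.1 q.2, ξ.2.2)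
          ∂(β (ξ.2.1 i.castSucc) (ξ.2.1 i.succ))
      + g (ξ.1, Function.update ξ.2.1 (Fin.last n) 0, toNat (ξ.2.1 (Fin.last n)) + ξ.2.2) := by
  rw [dualChainKernel_apply, lintegral_add_measure, lintegral_add_measure,
    lintegral_finsetSum_measure, lintegral_dirac, lintegral_dirac]
  simp only [lintegral_map (measurable_of_countable g) (measurable_of_countable _)]

theorem isJumpGenerator_dualChainKernel [∀ m l, IsProbabilityMeasure (β m l)]
    {G : (DualConfig n S → ℝ) → DualConfig n S → ℝ}
    (hG : ∀ f : DualConfig n S → ℝ, (∃ C : ℝ, ∀ x, |f x| ≤ C) → ∀ ξ,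
      G f ξ = absorb toNat f ξ
        + ∑ i : Fin n, ∫ q, (f (ξ.1, setBond ξ.2.1 i q.1 q.2, ξ.2.2) - f ξ)
            ∂(β (ξ.2.1 i.castSucc) (ξ.2.1 i.succ))) :
    IsJumpGenerator G (dualChainKernel n toNat β) (n + 2 : ℕ) := by
  rintro f hf ⟨C, hC⟩ ξ
  rw [hG f ⟨C, hC⟩]
  have hint : ∀ (μ : Measure (DualConfig n S)) [IsFiniteMeasure μ], Integrable f μ :=
    fun μ _ => integrable_of_bounded hf hC
  rw [dualChainKernel_apply, integral_add_measure, integral_add_measure (hint _),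
    integral_finsetSum_measure fun i _ => hint _, integral_dirac, integral_dirac]
  · simp only [integral_map (measurable_of_countable _).aemeasurable hf.aestronglyMeasurable]
    have h2 : ∀ i : Fin n, ∫ q, (f (ξ.1, setBond ξ.2.1 i q.1 q.2, ξ.2.2) - f ξ)
          ∂(β (ξ.2.1 i.castSucc) (ξ.2.1 i.succ))
        = ∫ q, f (ξ.1, setBond ξ.2.1 i q.1 q.2, ξ.2.2)
          ∂(β (ξ.2.1 i.castSucc) (ξ.2.1 i.succ)) - f ξ := by
      intro i
      rw [integral_sub (integrable_of_bounded (measurable_of_countable _) fun r => hC _)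
        (integrable_const _)]
      simp
    simp only [h2, Finset.sum_sub_distrib, Finset.sum_const, Finset.card_univ, Fintype.card_fin,
      nsmul_eq_mul, absorb]
    push_cast
    ring
  · exact integrable_finsetSum_measure.2 fun i _ => hint _
  · exact (hint _).add_measure (integrable_finsetSum_measure.2 fun i _ => hint _)
  · exact hint _

theorem ae_totalNumber_eq (h0 : toNat 0 = 0)
    (hcons : ∀ m l, ∀ᵐ q ∂(β m l), toNat q.1 + toNat q.2 = toNat m + toNat l)
    (ξ : DualConfig n S) :
    ∀ᵐ ξ' ∂(dualChainKernel n toNat β ξ), totalNumber toNat ξ' = totalNumber toNat ξ := by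
  have h1 := sum_update_site toNat ξ.2.1 0 0
  have h2 := sum_update_site toNat ξ.2.1 (Fin.last n) 0
  rw [h0] at h1 h2
  rw [dualChainKernel_apply, ae_add_measure_iff, ae_add_measure_iff, ae_dirac_eq, ae_dirac_eq]
  refine ⟨⟨?_, ?_⟩, ?_⟩
  · simp only [eventually_pure, totalNumber]; omega
  · rw [← Measure.sum_fintype, Measure.ae_sum_iff]
    intro i
    rw [ae_map_iff (measurable_of_countable _).aemeasurable (Set.to_countable _).measurableSet]
    filter_upwards [hcons _ _] with q hq
    simp only [totalNumber, sum_setBond toNat ξ.2.1 i hq]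
  · simp only [eventually_pure, totalNumber]; omega

end DualKernel

/-! ### Reduction to single-site and single-bond relations -/

section ChainDuality

variable {n : ℕ} {S S' : Type} [MeasurableSpace S] [MeasurableSpace S'] [Countable S']
  [MeasurableSingletonClass S'] [Zero S']

/-- A duality function in product form. -/
def productDuality (n : ℕ) (d : S → S' → ℝ) (A B : ℝ) (η : Config n S) (ξ : DualConfig n S') : ℝ :=
  A ^ ξ.1 * (∏ i, d (η i) (ξ.2.1 i)) * B ^ ξ.2.2

/-- The single-site and single-bond relations that make a chain with reservoirs dual to a chain
with absorbing boundary sites. -/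
structure LocalDuality (toNat : S' → ℕ) (μa μb : Measure S) (β : Kernel (S × S) (S × S))
    (β' : S' → S' → Measure (S' × S')) (d : S → S' → ℝ) (A B : ℝ) : Prop where
  toNat_zero : toNat 0 = 0
  injective : Function.Injective toNat
  measurable : ∀ m, Measurable fun x => d x m
  nonneg : ∀ x m, 0 ≤ d x m
  apply_zero : ∀ x, d x 0 = 1
  left_nonneg : 0 ≤ A
  right_nonneg : 0 ≤ B
  left : ∀ m, ∫⁻ r, ENNReal.ofReal (d r m) ∂μa = ENNReal.ofReal (A ^ toNat m)
  right : ∀ m, ∫⁻ r, ENNReal.ofReal (d r m) ∂μb = ENNReal.ofReal (B ^ toNat m)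
  bond : ∀ x y m l, ∫⁻ q, ENNReal.ofReal (d q.1 m * d q.2 l) ∂(β (x, y))
    = ∫⁻ q, ENNReal.ofReal (d x q.1 * d y q.2) ∂(β' m l)
  conserves : ∀ m l, ∀ᵐ q ∂(β' m l), toNat q.1 + toNat q.2 = toNat m + toNat l

variable {toNat : S' → ℕ} {μa μb : Measure S} {β : Kernel (S × S) (S × S)}
  {β' : S' → S' → Measure (S' × S')} {d : S → S' → ℝ} {A B : ℝ}

theorem LocalDuality.measurable_productDuality (h : LocalDuality toNat μa μb β β' d A B) :
    Measurable (Function.uncurry (productDuality n d A B)) := by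
  refine measurable_from_prod_countable_left fun ξ => ?_
  simp only [Function.uncurry, productDuality]
  exact ((Finset.measurable_prod _ fun i _ =>
    (h.measurable (ξ.2.1 i)).comp (measurable_pi_apply i)).const_mul _).mul_const _

variable [IsProbabilityMeasure μa] [IsProbabilityMeasure μb] [IsMarkovKernel β]

/-- The jumps match term by term: reservoir with absorption at the same end, bond with the same
bond, the untouched sites giving a common factor. A resampled end site contributes `A ^ ξ₁` or `B ^
ξ_L`, the weight of the absorbed particles, while the emptied site contributes `d x 0 = 1`. As the
two ends are never compared, a single-site chain needs no separate treatment. -/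
theorem LocalDuality.lintegral_chainKernel_eq (h : LocalDuality toNat μa μb β β' d A B)
    (η : Config n S) (ξ : DualConfig n S') :
    ∫⁻ η', ENNReal.ofReal (productDuality n d A B η' ξ) ∂(chainKernel n μa μb β η)
      = ∫⁻ ξ', ENNReal.ofReal (productDuality n d A B η ξ') ∂(dualChainKernel n toNat β' ξ) := by
  have hm : Measurable fun η' => ENNReal.ofReal (productDuality n d A B η' ξ) :=
    (h.measurable_productDuality.comp measurable_prodMk_right).ennreal_ofReal
  have hA := h.left_nonneg
  have hB := h.right_nonneg
  rw [lintegral_chainKernel _ _ _ _ hm, lintegral_dualChainKernel]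
  have hprod : ∀ (s : Finset (Fin (n + 1))), 0 ≤ ∏ j ∈ s, d (η j) (ξ.2.1 j) :=
    fun s => Finset.prod_nonneg fun j _ => h.nonneg _ _
  have site : ∀ (i : Fin (n + 1)) (r : S), productDuality n d A B (Function.update η i r) ξ
      = (A ^ ξ.1 * (∏ j ∈ Finset.univ.erase i, d (η j) (ξ.2.1 j)) * B ^ ξ.2.2)
        * d r (ξ.2.1 i) := by
    intro i r
    have := prod_update_site d η ξ.2.1 i r (ξ.2.1 i)
    rw [Function.update_eq_self] at this
    rw [productDuality, this]; ring
  have site' : ∀ (i : Fin (n + 1)), ∏ j, d (η j) (Function.update ξ.2.1 i 0 j)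
      = ∏ j ∈ Finset.univ.erase i, d (η j) (ξ.2.1 j) := by
    intro i
    have := prod_update_site d η ξ.2.1 i (η i) 0
    rwa [Function.update_eq_self, h.apply_zero, one_mul] at this
  congr 1
  · congr 1
    · simp only [site]
      have h0 : 0 ≤ A ^ ξ.1 * (∏ j ∈ Finset.univ.erase 0, d (η j) (ξ.2.1 j)) * B ^ ξ.2.2 :=
        mul_nonneg (mul_nonneg (by positivity) (hprod _)) (by positivity)
      simp only [ENNReal.ofReal_mul h0]
      rw [lintegral_const_mul _ (h.measurable _).ennreal_ofReal, h.left, ← ENNReal.ofReal_mul h0,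
        productDuality, site']
      congr 1
      rw [pow_add]; ring
    · refine Finset.sum_congr rfl fun i _ => ?_
      have e : ∀ r s m l, ∏ j, d (setBond η i r s j) (setBond ξ.2.1 i m l j) = _ :=
        prod_setBond d η ξ.2.1 i
      have e1 : ∀ q : S × S, productDuality n d A B (setBond η i q.1 q.2) ξ
          = (A ^ ξ.1 * (∏ j ∈ (Finset.univ.erase i.castSucc).erase i.succ, d (η j) (ξ.2.1 j))
            * B ^ ξ.2.2) * (d q.1 (ξ.2.1 i.castSucc) * d q.2 (ξ.2.1 i.succ)) := by
        intro q
        have := e q.1 q.2 (ξ.2.1 i.castSucc) (ξ.2.1 i.succ)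
        rw [setBond_self] at this
        rw [productDuality, this]; ring
      have e2 : ∀ q : S' × S', productDuality n d A B η (ξ.1, setBond ξ.2.1 i q.1 q.2, ξ.2.2)
          = (A ^ ξ.1 * (∏ j ∈ (Finset.univ.erase i.castSucc).erase i.succ, d (η j) (ξ.2.1 j))
            * B ^ ξ.2.2) * (d (η i.castSucc) q.1 * d (η i.succ) q.2) := by
        intro q
        have := e (η i.castSucc) (η i.succ) q.1 q.2
        rw [setBond_self] at this
        rw [productDuality, this]; ring
      have h0 : 0 ≤ A ^ ξ.1 * (∏ j ∈ (Finset.univ.erase i.castSucc).erase i.succ,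
          d (η j) (ξ.2.1 j)) * B ^ ξ.2.2 :=
        mul_nonneg (mul_nonneg (by positivity) (hprod _)) (by positivity)
      simp only [e1, e2, ENNReal.ofReal_mul h0]
      have hmeas : Measurable fun q : S × S =>
          ENNReal.ofReal (d q.1 (ξ.2.1 i.castSucc) * d q.2 (ξ.2.1 i.succ)) :=
        Measurable.ennreal_ofReal
          (((h.measurable _).comp measurable_fst).mul ((h.measurable _).comp measurable_snd))
      rw [lintegral_const_mul _ hmeas, lintegral_const_mul _ (measurable_of_countable _), h.bond]
  · simp only [site]
    have h0 : 0 ≤ A ^ ξ.1 * (∏ j ∈ Finset.univ.erase (Fin.last n), d (η j) (ξ.2.1 j))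
        * B ^ ξ.2.2 :=
      mul_nonneg (mul_nonneg (by positivity) (hprod _)) (by positivity)
    simp only [ENNReal.ofReal_mul h0]
    rw [lintegral_const_mul _ (h.measurable _).ennreal_ofReal, h.right, ← ENNReal.ofReal_mul h0,
      productDuality, site']
    congr 1
    rw [pow_add]; ring

theorem LocalDuality.generateDualProcesses [∀ m l, IsProbabilityMeasure (β' m l)]
    (h : LocalDuality toNat μa μb β β' d A B)
    {G : (Config n S → ℝ) → Config n S → ℝ}
    {G' : (DualConfig n S' → ℝ) → DualConfig n S' → ℝ}
    (hG : ∀ f : Config n S → ℝ, Measurable f → (∃ C : ℝ, ∀ x, |f x| ≤ C) → ∀ η,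
      G f η = ∫ r, (f (Function.update η 0 r) - f η) ∂μa
        + ∑ i : Fin n, ∫ q, (f (setBond η i q.1 q.2) - f η) ∂(β (η i.castSucc, η i.succ))
        + ∫ r, (f (Function.update η (Fin.last n) r) - f η) ∂μb)
    (hG' : ∀ f : DualConfig n S' → ℝ, (∃ C : ℝ, ∀ x, |f x| ≤ C) → ∀ ξ,
      G' f ξ = absorb toNat f ξ
        + ∑ i : Fin n, ∫ q, (f (ξ.1, setBond ξ.2.1 i q.1 q.2, ξ.2.2) - f ξ)
            ∂(β' (ξ.2.1 i.castSucc) (ξ.2.1 i.succ))) :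
    GenerateDualProcesses G G' (productDuality n d A B) := by
  refine generateDualProcesses_of_jump (chainKernel_apply_univ μa μb β)
    (dualChainKernel_apply_univ toNat β') (isJumpGenerator_chainKernel μa μb β hG)
    (isJumpGenerator_dualChainKernel toNat β' hG') h.measurable_productDuality ?_
    h.lintegral_chainKernel_eq (measurable_of_countable (totalNumber toNat))
    (ae_totalNumber_eq toNat β' h.toNat_zero h.conserves) ?_
  · intro η ξ
    have hA := h.left_nonneg
    have hB := h.right_nonneg
    exact mul_nonneg (mul_nonneg (by positivity)
      (Finset.prod_nonneg fun j _ => h.nonneg _ _)) (by positivity)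
  · intro η M
    obtain ⟨C, hC⟩ := ((finite_totalNumber_eq (n := n) h.injective M).image
      (productDuality n d A B η)).bddAbove
    exact ⟨C, fun ξ hξ => hC ⟨ξ, hξ, rfl⟩⟩

end ChainDuality

/-! ### Weights, Vandermonde convolutions and factorial moments -/

section Combinatorics


/-- The sum of `F` over the antidiagonal of `E`. -/
abbrev convSum (F : ℕ → ℕ → ℝ) (E : ℕ) : ℝ :=
  ∑ q ∈ Finset.HasAntidiagonal.antidiagonal E, F q.1 q.2

/-- Used for factorial moments, where binomial coefficients kill all terms with `r < m` or `s < l`.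
-/
theorem convSum_shift {F : ℕ → ℕ → ℝ} {m l : ℕ} (h1 : ∀ r s, r < m → F r s = 0)
    (h2 : ∀ r s, s < l → F r s = 0) (E : ℕ) :
    convSum F (E + (m + l)) = convSum (fun i j => F (i + m) (j + l)) E := by
  symm
  refine Finset.sum_of_injOn (fun q => (q.1 + m, q.2 + l)) ?_ ?_ ?_ ?_
  · rintro ⟨a, b⟩ _ ⟨a', b'⟩ _ h
    simp only [Prod.mk.injEq] at h ⊢
    omega
  · intro q hq
    simp only [Finset.mem_coe, Finset.HasAntidiagonal.mem_antidiagonal] at hq ⊢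
    omega
  · rintro ⟨r, s⟩ hq hn
    simp only [Finset.HasAntidiagonal.mem_antidiagonal] at hq
    by_cases hr : r < m
    · exact h1 _ _ hr
    by_cases hs : s < l
    · exact h2 _ _ hs
    · refine absurd ⟨(r - m, s - l), ?_, ?_⟩ hn
      · simp only [Finset.mem_coe, Finset.HasAntidiagonal.mem_antidiagonal]; omega
      · simp only [Prod.mk.injEq]; omega
  · intro q _; rfl

theorem convSum_eq_zero {F : ℕ → ℕ → ℝ} {m l : ℕ} (h1 : ∀ r s, r < m → F r s = 0)
    (h2 : ∀ r s, s < l → F r s = 0) {E : ℕ} (hE : E < m + l) : convSum F E = 0 := by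
  refine Finset.sum_eq_zero fun q hq => ?_
  rw [Finset.HasAntidiagonal.mem_antidiagonal] at hq
  by_cases hr : q.1 < m
  · exact h1 _ _ hr
  · exact h2 _ _ (by omega)

/-- Weights `w` with convolution square `W` for which the redistribution probabilities
`w r * w (E - r) / W E` have factorial moments of product form. -/
structure IsThermalWeight (w W : ℕ → ℝ) : Prop where
  conv : ∀ E, convSum (fun r s => w r * w s) E = W E
  moment : ∀ E m l, convSum (fun r s => w r * w s * (r.choose m * s.choose l)) E * W (m + l)
    = w m * w l * (W E * E.choose (m + l))

/-- The factor `binom(r, m)` turns the weight `w` into a shifted weight `v m`, up to the constant `w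
m`. The shifted weights again convolve explicitly, which gives the mixed moments. The identity
`moment` is cleared of denominators, so the weights are allowed to vanish. -/
theorem IsThermalWeight.of_shift {w W : ℕ → ℝ} {v : ℕ → ℕ → ℝ}
    (conv : ∀ E, convSum (fun r s => w r * w s) E = W E)
    (shift : ∀ i m, w (i + m) * ((i + m).choose m : ℝ) = w m * v m i)
    (hv : ∀ E m l, convSum (fun i j => v m i * v l j) E * W (m + l)
      = W (E + (m + l)) * ((E + (m + l)).choose (m + l) : ℝ)) : IsThermalWeight w W := by
  refine ⟨conv, fun E m l => ?_⟩
  have h1 : ∀ r s : ℕ, r < m → w r * w s * ((r.choose m : ℝ) * s.choose l) = 0 := by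
    intro r s h; simp [Nat.choose_eq_zero_of_lt h]
  have h2 : ∀ r s : ℕ, s < l → w r * w s * ((r.choose m : ℝ) * s.choose l) = 0 := by
    intro r s h; simp [Nat.choose_eq_zero_of_lt h]
  rcases lt_or_ge E (m + l) with hE | hE
  · rw [convSum_eq_zero h1 h2 hE, Nat.choose_eq_zero_of_lt hE]; simp
  · obtain ⟨F, rfl⟩ := Nat.exists_eq_add_of_le' hE
    rw [convSum_shift h1 h2, ← hv, ← mul_assoc, convSum, convSum, Finset.mul_sum]
    congr 1
    refine Finset.sum_congr rfl fun q _ => ?_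
    linear_combination w (q.2 + l) * ((q.2 + l).choose l : ℝ) * shift q.1 m
      + w m * v m q.1 * shift q.2 l

theorem IsThermalWeight.bond_sum {w W : ℕ → ℝ} (h : IsThermalWeight w W) {E m l : ℕ}
    (hm : w m ≠ 0) (hl : w l ≠ 0) (hE : W E ≠ 0) (hM : W (m + l) ≠ 0) :
    convSum (fun r s => r.choose m / w m * (s.choose l / w l) * (w r * w s / W E)) E
      = E.choose (m + l) / W (m + l) := by
  rw [eq_div_iff hM]
  have := h.moment E m l
  have e : convSum (fun r s => r.choose m / w m * (s.choose l / w l) * (w r * w s / W E)) E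
      = convSum (fun r s => w r * w s * (r.choose m * s.choose l)) E / (w m * w l * W E) := by
    rw [convSum, convSum, Finset.sum_div]
    exact Finset.sum_congr rfl fun q _ => by field_simp
  rw [e, div_mul_eq_mul_div, this]
  field_simp

theorem convSum_choose (x y M : ℕ) :
    convSum (fun m l => (x.choose m : ℝ) * y.choose l) M = (x + y).choose M := by
  rw [Nat.add_choose_eq]; push_cast; rfl

/-- The weights cancel and Vandermonde remains. Where a weight vanishes (exclusion, more than `N`
particles), so does the binomial coefficient, and the convention `0 / 0 = 0` is harmless. With `M =
m + l` and `E = x + y` the value is that of `IsThermalWeight.bond_sum`. -/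
theorem dual_bond_sum {w W : ℕ → ℝ} {x y M : ℕ} (hx : ∀ m, w m = 0 → x.choose m = 0)
    (hy : ∀ m, w m = 0 → y.choose m = 0) :
    convSum (fun m l => x.choose m / w m * (y.choose l / w l) * (w m * w l / W M)) M
      = (x + y).choose M / W M := by
  rw [← convSum_choose, convSum, convSum, Finset.sum_div]
  refine Finset.sum_congr rfl fun q _ => ?_
  by_cases h1 : w q.1 = 0
  · simp [hx _ h1]
  by_cases h2 : w q.2 = 0
  · simp [hy _ h2]
  field_simp

theorem convSum_ring_choose (x y : ℝ) (E : ℕ) :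
    convSum (fun r s => Ring.choose x r * Ring.choose y s) E = Ring.choose (x + y) E :=
  (Ring.add_choose_eq E (Commute.all x y)).symm

theorem ring_choose_shift (x : ℝ) (i m : ℕ) :
    Ring.choose x (i + m) * ((i + m).choose m : ℝ) = Ring.choose x m * Ring.choose (x - m) i := by
  have := Ring.choose_smul_choose x (Nat.le_add_left m i)
  rw [Nat.add_sub_cancel, nsmul_eq_mul] at this
  rw [← this, mul_comm]

/-- The real parameter covers two models: `x = N` is exclusion, and `x = -2k` is inclusion up to
signs. -/
theorem isThermalWeight_ring_choose (x : ℝ) :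
    IsThermalWeight (Ring.choose x) (Ring.choose (2 * x)) := by
  refine .of_shift (v := fun m i => Ring.choose (x - m) i) ?_ (ring_choose_shift x) ?_
  · intro E
    rw [convSum_ring_choose, two_mul]
  · intro E m l
    rw [convSum_ring_choose, ring_choose_shift, mul_comm]
    congr 2
    push_cast; ring

/-- The sign `(-1) ^ (r + s)` is constant on each antidiagonal. -/
theorem IsThermalWeight.sign {w W : ℕ → ℝ} (h : IsThermalWeight w W) :
    IsThermalWeight (fun r => (-1) ^ r * w r) (fun r => (-1) ^ r * W r) := by
  constructor
  · intro E
    rw [← h.conv, convSum, convSum, Finset.mul_sum]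
    refine Finset.sum_congr rfl fun q hq => ?_
    rw [← Finset.HasAntidiagonal.mem_antidiagonal.1 hq, pow_add]; ring
  · intro E m l
    have e : convSum (fun r s => (-1) ^ r * w r * ((-1) ^ s * w s)
        * (r.choose m * s.choose l)) E
        = (-1) ^ E * convSum (fun r s => w r * w s * (r.choose m * s.choose l)) E := by
      rw [convSum, convSum, Finset.mul_sum]
      refine Finset.sum_congr rfl fun q hq => ?_
      rw [← Finset.HasAntidiagonal.mem_antidiagonal.1 hq, pow_add]; ring
    rw [e, pow_add]
    linear_combination ((-1) ^ E * ((-1) ^ m * (-1) ^ l)) * h.moment E m l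

theorem multichoose_eq_choose_neg (a : ℝ) (r : ℕ) :
    Ring.multichoose a r = (-1) ^ r * Ring.choose (-a) r := by
  rw [Ring.choose_neg', Int.negOnePow_def, zpow_natCast, Units.smul_def, Units.val_pow_eq_pow_val,
    zsmul_eq_mul, ← mul_assoc]
  push_cast
  rw [← mul_pow]; simp

theorem isThermalWeight_multichoose (a : ℝ) :
    IsThermalWeight (Ring.multichoose a) (Ring.multichoose (2 * a)) := by
  have h := (isThermalWeight_ring_choose (-a)).sign
  have e1 : Ring.multichoose a = fun r => (-1) ^ r * Ring.choose (-a) r :=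
    funext (multichoose_eq_choose_neg a)
  have e2 : Ring.multichoose (2 * a) = fun r => (-1) ^ r * Ring.choose (2 * -a) r := by
    funext r; rw [multichoose_eq_choose_neg, mul_neg]
  rwa [e1, e2]

theorem multichoose_shift (a : ℝ) (i m : ℕ) :
    Ring.multichoose a (i + m) * ((i + m).choose m : ℝ)
      = Ring.multichoose a m * Ring.multichoose (a + m) i := by
  simp only [multichoose_eq_choose_neg]
  have h := ring_choose_shift (-a) i m
  rw [show -a - m = -(a + m) by ring] at h
  rw [pow_add]
  linear_combination ((-1) ^ i * (-1) ^ m) * h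

theorem isThermalWeight_choose (N : ℕ) :
    IsThermalWeight (fun r => (N.choose r : ℝ)) (fun r => ((2 * N).choose r : ℝ)) := by
  have := isThermalWeight_ring_choose (N : ℝ)
  rw [show (2 * N : ℝ) = ((2 * N : ℕ) : ℝ) by push_cast; ring] at this
  have e : ∀ M : ℕ, Ring.choose (M : ℝ) = fun r => (M.choose r : ℝ) :=
    fun M => funext (Ring.choose_natCast M)
  rwa [e, e] at this

theorem convSum_inv_factorial (E : ℕ) :
    convSum (fun r s => 1 / (r.factorial : ℝ) * (1 / s.factorial)) E = 2 ^ E / E.factorial := by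
  rw [← one_add_one_eq_two, (Commute.all (1 : ℝ) 1).add_pow', Finset.sum_div]
  refine Finset.sum_congr rfl fun p hp => ?_
  rw [Finset.HasAntidiagonal.mem_antidiagonal] at hp
  subst hp
  have h := Nat.choose_mul_factorial_mul_factorial (Nat.le_add_right p.1 p.2)
  rw [Nat.add_sub_cancel_left] at h
  have h' : ((p.1 + p.2).choose p.1 : ℝ) * p.1.factorial * p.2.factorial
    = (p.1 + p.2).factorial := by exact_mod_cast h
  have h1 : ((p.1 + p.2).choose p.1 : ℝ) ≠ 0 := by
    exact_mod_cast (Nat.choose_pos (Nat.le_add_right _ _)).ne'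
  rw [← h', nsmul_eq_mul]
  field_simp
  simp

theorem factorial_add_eq (i m : ℕ) :
    ((i + m).factorial : ℝ) = (i + m).choose m * m.factorial * i.factorial := by
  have h := Nat.choose_mul_factorial_mul_factorial (Nat.le_add_left m i)
  rw [Nat.add_sub_cancel] at h
  exact_mod_cast h.symm

theorem inv_factorial_shift (i m : ℕ) : 1 / ((i + m).factorial : ℝ) * ((i + m).choose m : ℝ)
    = 1 / m.factorial * (1 / i.factorial) := by
  have h1 : ((i + m).choose m : ℝ) ≠ 0 := by
    exact_mod_cast (Nat.choose_pos (Nat.le_add_left _ _)).ne'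
  rw [factorial_add_eq]
  field_simp

theorem isThermalWeight_inv_factorial :
    IsThermalWeight (fun r => 1 / (r.factorial : ℝ)) (fun r => 2 ^ r / r.factorial) := by
  refine .of_shift (v := fun _ i => 1 / (i.factorial : ℝ)) convSum_inv_factorial
    inv_factorial_shift ?_
  intro E m l
  have h := inv_factorial_shift E (m + l)
  rw [convSum_inv_factorial, pow_add]
  linear_combination (-(2 ^ E * 2 ^ (m + l)) : ℝ) * h

/-- Both sides are the rising factorial `a (a + 1) ⋯ (a + m - 1)`. -/
theorem multichoose_mul_factorial {a : ℝ} (ha : 0 < a) (m : ℕ) :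
    Ring.multichoose a m * m.factorial = Real.Gamma (a + m) / Real.Gamma a := by
  have h := Ring.factorial_nsmul_multichoose_eq_ascPochhammer a m
  rw [Polynomial.ascPochhammer_smeval_eq_eval, nsmul_eq_mul, mul_comm] at h
  rw [h, eq_div_iff (Real.Gamma_pos_of_pos ha).ne']
  clear h
  induction m with
  | zero => simp
  | succ m ih =>
    rw [ascPochhammer_succ_eval, Nat.cast_succ, ← add_assoc,
      Real.Gamma_add_one (by positivity), ← ih]
    ring

theorem multichoose_pos {a : ℝ} (ha : 0 < a) (m : ℕ) : 0 < Ring.multichoose a m := by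
  have h := multichoose_mul_factorial ha m
  have : 0 < Ring.multichoose a m * m.factorial := by
    rw [h]
    exact div_pos (Real.Gamma_pos_of_pos (by positivity)) (Real.Gamma_pos_of_pos ha)
  exact pos_of_mul_pos_left this (by positivity)

theorem descFactorial_mul_Gamma {a : ℝ} (ha : 0 < a) (x m : ℕ) :
    (x.descFactorial m : ℝ) * (Real.Gamma a / Real.Gamma (a + m))
      = x.choose m / Ring.multichoose a m := by
  have h := multichoose_mul_factorial ha m
  have h1 := (Real.Gamma_pos_of_pos ha).ne'
  have h2 := (Real.Gamma_pos_of_pos (show 0 < a + m by positivity)).ne'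
  have h3 := (multichoose_pos ha m).ne'
  rw [Nat.descFactorial_eq_factorial_mul_choose, Nat.cast_mul]
  rw [eq_div_iff h1] at h
  rw [← h]
  field_simp

theorem hasSum_multichoose (a : ℝ) {ρ : ℝ} (h0 : 0 ≤ ρ) (h1 : ρ < 1) :
    HasSum (fun r => Ring.multichoose a r * ρ ^ r) ((1 - ρ) ^ (-a)) := by
  have := (Real.one_div_one_sub_rpow_hasFPowerSeriesOnBall_zero a).hasSum (y := ρ)
    (by simp [enorm_eq_nnnorm, ← NNReal.coe_lt_coe, abs_of_nonneg h0, h1])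
  rw [zero_add, one_div, ← Real.rpow_neg (by linarith)] at this
  convert! this using 1
  funext r
  simp [FormalMultilinearSeries.ofScalars, Ring.multichoose_eq, mul_comm]

/-- Factorial moments from the moments of the shifted weights. -/
theorem hasSum_choose_of_shift {w : ℕ → ℝ} {v : ℕ → ℝ} {m : ℕ} {ρ V : ℝ} (hm : w m ≠ 0)
    (shift : ∀ i, w (i + m) * ((i + m).choose m : ℝ) = w m * v i)
    (hv : HasSum (fun i => v i * ρ ^ i) V) :
    HasSum (fun r => r.choose m / w m * (w r * ρ ^ r)) (ρ ^ m * V) := by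
  rw [← hasSum_nat_add_iff' m]
  have h0 : ∑ i ∈ Finset.range m, (i.choose m / w m * (w i * ρ ^ i) : ℝ) = 0 :=
    Finset.sum_eq_zero fun i hi => by simp [Nat.choose_eq_zero_of_lt (Finset.mem_range.1 hi)]
  rw [h0, sub_zero]
  convert! hv.mul_left (ρ ^ m) using 1
  funext i
  have : ((i + m).choose m / w m * (w (i + m) * ρ ^ (i + m)) : ℝ)
      = (w (i + m) * (i + m).choose m) / w m * ρ ^ (i + m) := by ring
  rw [this, shift, mul_div_cancel_left₀ _ hm, pow_add]
  ring

end Combinatorics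

/-! ### Integrals against discrete laws -/

section DiscreteLaws

variable {ι : Type*} [MeasurableSpace ι]

/-- The measure with weights `w` on the finite set `s`. -/
def finsetLaw (s : Finset ι) (w : ι → ℝ) : Measure ι :=
  ∑ p ∈ s, ENNReal.ofReal (w p) • Measure.dirac p

/-- The measure with weights `w`. -/
def discreteLaw (w : ι → ℝ) : Measure ι :=
  Measure.sum fun p => ENNReal.ofReal (w p) • Measure.dirac p

variable [MeasurableSingletonClass ι]

theorem lintegral_finsetLaw {s : Finset ι} {w : ι → ℝ} (hw : ∀ p ∈ s, 0 ≤ w p) {g : ι → ℝ}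
    (hg : ∀ p, 0 ≤ g p) :
    ∫⁻ p, ENNReal.ofReal (g p) ∂(finsetLaw s w) = ENNReal.ofReal (∑ p ∈ s, g p * w p) := by
  rw [finsetLaw, lintegral_finsetSum_measure,
    ENNReal.ofReal_sum_of_nonneg fun p hp => mul_nonneg (hg p) (hw p hp)]
  refine Finset.sum_congr rfl fun p hp => ?_
  rw [lintegral_smul_measure, lintegral_dirac, smul_eq_mul, ENNReal.ofReal_mul (hg p), mul_comm]

theorem integral_finsetLaw {s : Finset ι} {w : ι → ℝ} (hw : ∀ p ∈ s, 0 ≤ w p) (g : ι → ℝ) :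
    ∫ p, g p ∂(finsetLaw s w) = ∑ p ∈ s, g p * w p := by
  rw [finsetLaw, integral_finsetSum_measure]
  · refine Finset.sum_congr rfl fun p hp => ?_
    rw [integral_smul_measure, integral_dirac, ENNReal.toReal_ofReal (hw p hp), smul_eq_mul,
      mul_comm]
  · exact fun p _ => (integrable_dirac (by simp)).smul_measure ENNReal.ofReal_ne_top

theorem isProbabilityMeasure_finsetLaw {s : Finset ι} {w : ι → ℝ} (hw : ∀ p ∈ s, 0 ≤ w p)
    (h : ∑ p ∈ s, w p = 1) : IsProbabilityMeasure (finsetLaw s w) := by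
  have := lintegral_finsetLaw hw (g := fun _ => 1) fun _ => zero_le_one
  simp only [ENNReal.ofReal_one, lintegral_one, one_mul, h] at this
  exact ⟨this⟩

theorem ae_finsetLaw {s : Finset ι} {w : ι → ℝ} {p : ι → Prop} (hp : ∀ q ∈ s, p q) :
    ∀ᵐ q ∂(finsetLaw s w), p q := by
  rw [finsetLaw, ← Finset.sum_coe_sort, ← Measure.sum_fintype, Measure.ae_sum_iff]
  intro q
  refine Measure.ae_smul_measure ?_ _
  rw [ae_dirac_eq]
  exact hp q q.2

theorem lintegral_discreteLaw {w : ι → ℝ} (hw : ∀ p, 0 ≤ w p) {g : ι → ℝ}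
    (hg : ∀ p, 0 ≤ g p) {v : ℝ} (h : HasSum (fun p => g p * w p) v) :
    ∫⁻ p, ENNReal.ofReal (g p) ∂(discreteLaw w) = ENNReal.ofReal v := by
  rw [discreteLaw, lintegral_sum_measure, ← h.tsum_eq,
    ENNReal.ofReal_tsum_of_nonneg (fun p => mul_nonneg (hg p) (hw p)) h.summable]
  refine tsum_congr fun p => ?_
  rw [lintegral_smul_measure, lintegral_dirac, smul_eq_mul, ENNReal.ofReal_mul (hg p), mul_comm]

theorem isProbabilityMeasure_discreteLaw {w : ι → ℝ} (hw : ∀ p, 0 ≤ w p) (h : HasSum w 1) :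
    IsProbabilityMeasure (discreteLaw w) := by
  have := lintegral_discreteLaw hw (g := fun _ => 1) (fun _ => zero_le_one) (v := 1)
    (by simpa using h)
  simp only [ENNReal.ofReal_one, lintegral_one] at this
  exact ⟨this⟩

theorem integral_discreteLaw [Countable ι] {w : ι → ℝ} (hw : ∀ p, 0 ≤ w p) (h : HasSum w 1)
    {g : ι → ℝ} {C : ℝ} (hC : ∀ p, |g p| ≤ C) :
    ∫ p, g p ∂(discreteLaw w) = ∑' p, g p * w p := by
  have := isProbabilityMeasure_discreteLaw hw h
  have hi : Integrable g (discreteLaw w) := integrable_of_bounded (measurable_of_countable g) hC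
  rw [discreteLaw] at hi ⊢
  rw [← (hasSum_integral_measure hi).tsum_eq]
  refine tsum_congr fun p => ?_
  rw [integral_smul_measure, integral_dirac, ENNReal.toReal_ofReal (hw p), smul_eq_mul, mul_comm]

end DiscreteLaws

/-! ### Particle chains without exclusion: the common argument -/

section NatChains

variable {w W : ℕ → ℝ} {ν : ℕ → ℕ → ℝ}

/-- The probabilities `ν` redistribute according to the weight `w` with convolution square `W`. -/
structure IsRedistribution (w W : ℕ → ℝ) (ν : ℕ → ℕ → ℝ) : Prop extends IsThermalWeight w W where
  pos : ∀ r, 0 < w r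
  pos' : ∀ r, 0 < W r
  zero_eq_one : w 0 = 1
  eq_div : ∀ r s, ν r (r + s) = w r * w s / W (r + s)

/-- The law of the redistributed particles on a bond. -/
def natBond (ν : ℕ → ℕ → ℝ) (x y : ℕ) : Measure (ℕ × ℕ) :=
  finsetLaw (Finset.HasAntidiagonal.antidiagonal (x + y)) fun q => ν q.1 (x + y)

theorem IsRedistribution.apply_antidiagonal (h : IsRedistribution w W ν) {E : ℕ} {q : ℕ × ℕ}
    (hq : q ∈ Finset.HasAntidiagonal.antidiagonal E) : ν q.1 E = w q.1 * w q.2 / W E := by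
  rw [← Finset.HasAntidiagonal.mem_antidiagonal.1 hq, h.eq_div]

theorem IsRedistribution.nonneg (h : IsRedistribution w W ν) {E : ℕ} :
    ∀ q ∈ Finset.HasAntidiagonal.antidiagonal E, 0 ≤ ν q.1 E := fun q hq => by
  rw [h.apply_antidiagonal hq]
  exact (div_pos (mul_pos (h.pos _) (h.pos _)) (h.pos' _)).le

theorem IsRedistribution.isProbabilityMeasure_natBond (h : IsRedistribution w W ν) (x y : ℕ) :
    IsProbabilityMeasure (natBond ν x y) := by
  refine isProbabilityMeasure_finsetLaw h.nonneg ?_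
  rw [Finset.sum_congr rfl fun q hq => h.apply_antidiagonal hq, ← Finset.sum_div]
  exact (div_eq_one_iff_eq (h.pos' _).ne').2 (h.conv _)

theorem IsRedistribution.lintegral_natBond (h : IsRedistribution w W ν) {g : ℕ × ℕ → ℝ}
    (hg : ∀ q, 0 ≤ g q) (x y : ℕ) : ∫⁻ q, ENNReal.ofReal (g q) ∂(natBond ν x y)
      = ENNReal.ofReal (convSum (fun r s => g (r, s) * (w r * w s / W (x + y))) (x + y)) := by
  rw [natBond, lintegral_finsetLaw h.nonneg hg]
  exact congrArg _ (Finset.sum_congr rfl fun q hq => by rw [h.apply_antidiagonal hq])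

theorem natBond_conserves (x y : ℕ) : ∀ᵐ q ∂(natBond ν x y), id q.1 + id q.2 = id x + id y :=
  ae_finsetLaw fun _ hq => Finset.HasAntidiagonal.mem_antidiagonal.1 hq

theorem IsRedistribution.bulk_eq (h : IsRedistribution w W ν) {n : ℕ} (f : Config n ℕ → ℝ)
    (η : Config n ℕ) : bulk ν f η = ∑ i : Fin n,
      ∫ q, (f (setBond η i q.1 q.2) - f η) ∂(natBond ν (η i.castSucc) (η i.succ)) := by
  refine Finset.sum_congr rfl fun i _ => ?_
  rw [natBond, integral_finsetLaw h.nonneg,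
    Finset.Nat.sum_antidiagonal_eq_sum_range_succ
      (fun r s => (f (setBond η i r s) - f η) * ν r (η i.castSucc + η i.succ))]

/-- A weighted bond kernel on occupation numbers. -/
def natBondKernel (ν : ℕ → ℕ → ℝ) : Kernel (ℕ × ℕ) (ℕ × ℕ) :=
  Kernel.ofFunOfCountable fun p => natBond ν p.1 p.2

/-- The single-site duality function. -/
def siteDuality (w : ℕ → ℝ) (x m : ℕ) : ℝ := x.choose m / w m

theorem IsRedistribution.localDuality (h : IsRedistribution w W ν) {πa πb : ℕ → ℝ} {A B : ℝ}
    (hA : 0 ≤ A) (hB : 0 ≤ B) (ha0 : ∀ r, 0 ≤ πa r) (hb0 : ∀ r, 0 ≤ πb r)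
    (ha : ∀ m, HasSum (fun r => siteDuality w r m * πa r) (A ^ m))
    (hb : ∀ m, HasSum (fun r => siteDuality w r m * πb r) (B ^ m)) :
    LocalDuality id (discreteLaw πa) (discreteLaw πb) (natBondKernel ν) (natBond ν)
      (siteDuality w) A B where
  toNat_zero := rfl
  injective := Function.injective_id
  measurable _ := measurable_of_countable _
  nonneg x m := div_nonneg (Nat.cast_nonneg _) (h.pos m).le
  apply_zero x := by simp [siteDuality, h.zero_eq_one]
  left_nonneg := hA
  right_nonneg := hB
  left m := lintegral_discreteLaw ha0 (fun r => div_nonneg (Nat.cast_nonneg _) (h.pos m).le) (ha m)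
  right m := lintegral_discreteLaw hb0 (fun r => div_nonneg (Nat.cast_nonneg _) (h.pos m).le) (hb m)
  bond x y m l := by
    have hd : ∀ x m, 0 ≤ siteDuality w x m :=
      fun x m => div_nonneg (Nat.cast_nonneg _) (h.pos m).le
    show ∫⁻ q, _ ∂(natBond ν x y) = _
    rw [h.lintegral_natBond (g := fun q => siteDuality w q.1 m * siteDuality w q.2 l)
        (fun q => mul_nonneg (hd _ _) (hd _ _)),
      h.lintegral_natBond (g := fun q => siteDuality w x q.1 * siteDuality w y q.2)
        (fun q => mul_nonneg (hd _ _) (hd _ _))]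
    congr 1
    simp only [siteDuality]
    rw [h.bond_sum (h.pos m).ne' (h.pos l).ne' (h.pos' _).ne' (h.pos' _).ne',
      dual_bond_sum (fun r hr => absurd hr (h.pos r).ne') (fun r hr => absurd hr (h.pos r).ne')]
  conserves := natBond_conserves

theorem IsRedistribution.generateDualProcesses (h : IsRedistribution w W ν) (n : ℕ)
    {πa πb : ℕ → ℝ} {A B : ℝ}
    (hA : 0 ≤ A) (hB : 0 ≤ B) (ha0 : ∀ r, 0 ≤ πa r) (hb0 : ∀ r, 0 ≤ πb r)
    (ha : ∀ m, HasSum (fun r => siteDuality w r m * πa r) (A ^ m))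
    (hb : ∀ m, HasSum (fun r => siteDuality w r m * πb r) (B ^ m)) :
    GenerateDualProcesses
      (fun (f : Config n ℕ → ℝ) η => (∑' r : ℕ, (f (Function.update η 0 r) - f η) * πa r)
        + bulk ν f η + ∑' r : ℕ, (f (Function.update η (Fin.last n) r) - f η) * πb r)
      (fun (f : DualConfig n ℕ → ℝ) ξ =>
        absorb id f ξ + bulk ν (fun ζ => f (ξ.1, ζ, ξ.2.2)) ξ.2.1)
      (productDuality n (siteDuality w) A B) := by
  -- Normalisation of the reservoir law is its moment of order `0`.
  have hsa : HasSum πa 1 := by simpa [siteDuality, h.zero_eq_one] using ha 0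
  have hsb : HasSum πb 1 := by simpa [siteDuality, h.zero_eq_one] using hb 0
  have := isProbabilityMeasure_discreteLaw ha0 hsa
  have := isProbabilityMeasure_discreteLaw hb0 hsb
  have := h.isProbabilityMeasure_natBond
  have : IsMarkovKernel (natBondKernel ν) := ⟨fun p => h.isProbabilityMeasure_natBond p.1 p.2⟩
  refine (h.localDuality hA hB ha0 hb0 ha hb).generateDualProcesses ?_ ?_
  · rintro f - ⟨C, hC⟩ η
    have hC' : ∀ x, |f x - f η| ≤ C + C := fun x =>
      (abs_sub _ _).trans (add_le_add (hC _) (hC _))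
    rw [h.bulk_eq, integral_discreteLaw ha0 hsa fun r => hC' _,
      integral_discreteLaw hb0 hsb fun r => hC' _]
    rfl
  · rintro f - ξ
    rw [h.bulk_eq]

end NatChains

/-! ### Inclusion walkers -/

section Inclusion

theorem multichoose_sub_eq (a : ℝ) (r : ℕ) : Ring.choose (a + r - 1) r = Ring.multichoose a r :=
  (Ring.multichoose_eq a r).symm

theorem isRedistribution_nuSIP {k : ℝ} (hk : 0 < k) :
    IsRedistribution (Ring.multichoose (2 * k)) (Ring.multichoose (2 * (2 * k))) (nuSIP k) where
  toIsThermalWeight := isThermalWeight_multichoose _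
  pos := multichoose_pos (by positivity)
  pos' := multichoose_pos (by positivity)
  zero_eq_one := by simp
  eq_div r s := by
    rw [nuSIP, Nat.add_sub_cancel_left, multichoose_sub_eq, multichoose_sub_eq,
      multichoose_sub_eq, show 4 * k = 2 * (2 * k) by ring]

theorem negBinomial_nonneg {k a c : ℝ} (hk : 0 < k) (ha : 0 < a) (hac : a < c) (r : ℕ) :
    0 ≤ negBinomial k a c r := by
  have := multichoose_pos (show 0 < 2 * k by positivity) r
  have h1 : 0 < c := ha.trans hac
  have h2 : 0 < c - a := sub_pos.2 hac
  rw [negBinomial, multichoose_sub_eq]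
  positivity

/-- With `ρ = a / c`, the shift raises `2k` to `2k + m`, so the series gives `ρ^m (1 - ρ)^{-2k-m}`.
The normalisation `(1 - ρ)^{2k}` leaves `(ρ / (1 - ρ))^m`. -/
theorem hasSum_negBinomial {k a c : ℝ} (hk : 0 < k) (ha : 0 < a) (hac : a < c) (m : ℕ) :
    HasSum (fun r => siteDuality (Ring.multichoose (2 * k)) r m * negBinomial k a c r)
      ((a / (c - a)) ^ m) := by
  have hc : 0 < c := ha.trans hac
  have hca : 0 < c - a := sub_pos.2 hac
  have h1 : a / c < 1 := (div_lt_one hc).2 hac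
  have h := (hasSum_choose_of_shift (w := Ring.multichoose (2 * k)) (m := m)
    (multichoose_pos (by positivity) m).ne' (fun i => multichoose_shift _ i m)
    (hasSum_multichoose (2 * k + m) (by positivity) h1)).mul_right (((c - a) / c) ^ (2 * k))
  have e : (1 - a / c) = (c - a) / c := by field_simp
  have hp : 0 < (c - a) / c := by positivity
  rw [e, mul_assoc, ← Real.rpow_add hp, show -(2 * k + m) + 2 * k = -(m : ℝ) by ring,
    Real.rpow_neg hp.le, Real.rpow_natCast, ← div_eq_mul_inv, ← div_pow,
    show a / c / ((c - a) / c) = a / (c - a) by field_simp] at h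
  convert! h using 1
  funext r
  rw [siteDuality, negBinomial, multichoose_sub_eq]
  ring

theorem generateDualProcesses_thSIP (n : ℕ) {k α γ δ β : ℝ} (hk : 0 < k) (hα : 0 < α)
    (hαγ : α < γ) (hδ : 0 < δ) (hδβ : δ < β) :
    GenerateDualProcesses (thSIP n k α γ δ β) (thSIPDual n k) (dSIP n k α γ δ β) := by
  have hd : siteDuality (Ring.multichoose (2 * k)) = fun x m : ℕ =>
      (x.descFactorial m : ℝ) * (Real.Gamma (2 * k) / Real.Gamma (2 * k + m)) := by
    funext x m
    rw [descFactorial_mul_Gamma (by positivity), siteDuality]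
  have h := (isRedistribution_nuSIP hk).generateDualProcesses n
    (div_pos hα (sub_pos.2 hαγ)).le (div_pos hδ (sub_pos.2 hδβ)).le
    (negBinomial_nonneg hk hα hαγ) (negBinomial_nonneg hk hδ hδβ)
    (hasSum_negBinomial hk hα hαγ) (hasSum_negBinomial hk hδ hδβ)
  rw [hd] at h
  exact h

end Inclusion

/-! ### Independent walkers -/

section Independent

theorem isRedistribution_nuIRW : IsRedistribution (fun r => 1 / (r.factorial : ℝ))
    (fun r => 2 ^ r / (r.factorial : ℝ)) nuIRW where
  toIsThermalWeight := isThermalWeight_inv_factorial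
  pos _ := by positivity
  pos' _ := by positivity
  zero_eq_one := by simp
  eq_div r s := by
    have h := factorial_add_eq s r
    rw [add_comm s r] at h
    rw [nuIRW, h]
    have h1 : ((r + s).choose r : ℝ) ≠ 0 := by
      exact_mod_cast (Nat.choose_pos (Nat.le_add_right _ _)).ne'
    field_simp

/-- Shifting `1 / r!` reproduces the same exponential series, hence the moment `(a / c)^m`. -/
theorem hasSum_poissonRes (a c : ℝ) (m : ℕ) :
    HasSum (fun r => siteDuality (fun r => 1 / (r.factorial : ℝ)) r m * poissonRes a c r)
      ((a / c) ^ m) := by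
  have hexp : HasSum (fun i : ℕ => 1 / (i.factorial : ℝ) * (a / c) ^ i) (Real.exp (a / c)) := by
    have := NormedSpace.expSeries_div_hasSum_exp (a / c)
    rw [← Real.exp_eq_exp_ℝ] at this
    convert! this using 1
    funext i
    ring
  have h := (hasSum_choose_of_shift (w := fun r => 1 / (r.factorial : ℝ)) (m := m)
    (by positivity) (fun i => inv_factorial_shift i m) hexp).mul_right (Real.exp (-(a / c)))
  rw [mul_assoc, ← Real.exp_add, add_neg_cancel, Real.exp_zero, mul_one] at h
  convert! h using 1
  funext r
  rw [siteDuality, poissonRes]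
  ring

theorem generateDualProcesses_thIRW (n : ℕ) {α γ δ β : ℝ} (hα : 0 < α) (hγ : 0 < γ) (hδ : 0 < δ)
    (hβ : 0 < β) : GenerateDualProcesses (thIRW n α γ δ β) (thIRWDual n) (dIRW n α γ δ β) := by
  have hd : siteDuality (fun r => 1 / (r.factorial : ℝ)) = fun x m : ℕ =>
      (x.descFactorial m : ℝ) := by
    funext x m
    rw [siteDuality, Nat.descFactorial_eq_factorial_mul_choose, Nat.cast_mul]
    field_simp
  have h := isRedistribution_nuIRW.generateDualProcesses n
    (div_pos hα hγ).le (div_pos hδ hβ).le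
    (fun r => by unfold poissonRes; positivity) (fun r => by unfold poissonRes; positivity)
    (hasSum_poissonRes α γ) (hasSum_poissonRes δ β)
  rw [hd] at h
  exact h

end Independent

/-! ### Exclusion walkers -/

section Exclusion

variable {N : ℕ}

/-- The pairs of occupation numbers on a bond with `E` particles. -/
abbrev bondPairs (N E : ℕ) : Finset (Fin (N + 1) × Fin (N + 1)) :=
  Finset.univ.filter fun p => (p.1 : ℕ) + (p.2 : ℕ) = E

/-- Binomial weights vanish beyond `N`, so the constraint of at most `N` particles per site can be
dropped and the unrestricted convolution identities apply. -/
theorem sum_bondPairs {F : ℕ → ℕ → ℝ} (h1 : ∀ r s, N < r → F r s = 0)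
    (h2 : ∀ r s, N < s → F r s = 0) (E : ℕ) :
    ∑ p ∈ bondPairs N E, F p.1 p.2 = convSum F E := by
  refine Finset.sum_of_injOn (fun p => ((p.1 : ℕ), (p.2 : ℕ))) ?_ ?_ ?_ ?_
  · rintro ⟨a, b⟩ _ ⟨a', b'⟩ _ h
    simp only [Prod.mk.injEq] at h
    exact Prod.ext (Fin.ext h.1) (Fin.ext h.2)
  · intro p hp
    simpa using hp
  · rintro ⟨r, s⟩ hq hn
    by_cases hr : N < r
    · exact h1 _ _ hr
    by_cases hs : N < s
    · exact h2 _ _ hs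
    refine absurd ⟨(⟨r, by omega⟩, ⟨s, by omega⟩), ?_, rfl⟩ hn
    simpa using hq
  · intro p _; rfl

theorem nuSEP_add (r s : ℕ) :
    nuSEP N r (r + s) = (N.choose r : ℝ) * N.choose s / (2 * N).choose (r + s) := by
  rw [nuSEP, Nat.add_sub_cancel_left]

theorem nuSEP_nonneg (r E : ℕ) : 0 ≤ nuSEP N r E := by unfold nuSEP; positivity

/-- The law of the redistributed particles on a bond with at most `N` particles per site. -/
def finBond (N : ℕ) (x y : Fin (N + 1)) : Measure (Fin (N + 1) × Fin (N + 1)) :=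
  finsetLaw (bondPairs N (x + y)) fun p => nuSEP N p.1 (x + y)

theorem sum_bondPairs_nuSEP (E : ℕ) (g : ℕ → ℕ → ℝ) :
    ∑ p ∈ bondPairs N E, g p.1 p.2 * nuSEP N p.1 E
      = convSum (fun r s => g r s * ((N.choose r : ℝ) * N.choose s / (2 * N).choose E)) E := by
  rw [← sum_bondPairs (N := N)]
  · refine Finset.sum_congr rfl fun p hp => ?_
    rw [← (Finset.mem_filter.1 hp).2, nuSEP_add]
  · intro r s h; simp [Nat.choose_eq_zero_of_lt h]
  · intro r s h; simp [Nat.choose_eq_zero_of_lt h]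

theorem choose_two_mul_ne_zero {E : ℕ} (hE : E ≤ 2 * N) : ((2 * N).choose E : ℝ) ≠ 0 := by
  exact_mod_cast (Nat.choose_pos hE).ne'

theorem fin_add_le (x y : Fin (N + 1)) : (x + y : ℕ) ≤ 2 * N := by omega

theorem isProbabilityMeasure_finBond (x y : Fin (N + 1)) :
    IsProbabilityMeasure (finBond N x y) := by
  refine isProbabilityMeasure_finsetLaw (fun p _ => nuSEP_nonneg _ _) ?_
  have h := sum_bondPairs_nuSEP (N := N) (x + y) fun _ _ => 1
  simp only [one_mul] at h
  rw [h, convSum, ← Finset.sum_div,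
    div_eq_one_iff_eq (choose_two_mul_ne_zero (fin_add_le x y))]
  exact (isThermalWeight_choose N).conv _

theorem lintegral_finBond {g : ℕ → ℕ → ℝ} (hg : ∀ r s, 0 ≤ g r s) (x y : Fin (N + 1)) :
    ∫⁻ q, ENNReal.ofReal (g q.1 q.2) ∂(finBond N x y)
      = ENNReal.ofReal (convSum (fun r s => g r s *
        ((N.choose r : ℝ) * N.choose s / (2 * N).choose (x + y))) (x + y)) := by
  rw [finBond, lintegral_finsetLaw (fun p _ => nuSEP_nonneg _ _)
    (g := fun q : Fin (N + 1) × Fin (N + 1) => g q.1 q.2) (fun q => hg _ _), sum_bondPairs_nuSEP]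

theorem bulkSEP_eq {n : ℕ} (f : Config n (Fin (N + 1)) → ℝ) (η : Config n (Fin (N + 1))) :
    bulkSEP f η = ∑ i : Fin n,
      ∫ q, (f (setBond η i q.1 q.2) - f η) ∂(finBond N (η i.castSucc) (η i.succ)) := by
  refine Finset.sum_congr rfl fun i _ => ?_
  rw [finBond, integral_finsetLaw fun p _ => nuSEP_nonneg _ _]

/-- The law of the number of particles on a site in contact with a reservoir. -/
def finReservoir (N : ℕ) (a c : ℝ) : Measure (Fin (N + 1)) :=
  finsetLaw Finset.univ fun r => binomialRes N a c r

theorem binomialRes_nonneg {a c : ℝ} (ha : 0 < a) (hc : 0 < c) (r : ℕ) :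
    0 ≤ binomialRes N a c r := by unfold binomialRes; positivity

/-- With `N = m + M`, the shift leaves the binomial sum `(1 + a/c)^M`. It cancels `M` of the `N`
factors `c / (c + a)`, and the other `m` combine with `(a/c)^m`. -/
theorem sum_choose_mul_binomialRes {a c : ℝ} (ha : 0 < a) (hc : 0 < c) {m : ℕ} (hm : m ≤ N) :
    ∑ r : Fin (N + 1), siteDuality (fun r => (N.choose r : ℝ)) r m * binomialRes N a c r
      = (a / (a + c)) ^ m := by
  obtain ⟨M, rfl⟩ := Nat.exists_eq_add_of_le hm
  rw [Fin.sum_univ_eq_sum_range (fun r : ℕ => siteDuality (fun r => ((m + M).choose r : ℝ)) r m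
    * binomialRes (m + M) a c r), add_assoc, Finset.sum_range_add]
  have h0 : ∑ r ∈ Finset.range m, siteDuality (fun r => ((m + M).choose r : ℝ)) r m
      * binomialRes (m + M) a c r = 0 :=
    Finset.sum_eq_zero fun r hr => by
      simp [siteDuality, Nat.choose_eq_zero_of_lt (Finset.mem_range.1 hr)]
  have hmne : ((m + M).choose m : ℝ) ≠ 0 := by exact_mod_cast (Nat.choose_pos hm).ne'
  have h1 : ∀ i ∈ Finset.range (M + 1), siteDuality (fun r => ((m + M).choose r : ℝ)) (m + i) m
      * binomialRes (m + M) a c (m + i)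
      = ((a / c) ^ m * (c / (c + a)) ^ (m + M)) * ((a / c) ^ i * 1 ^ (M - i) * M.choose i) := by
    intro i _
    have hs := ring_choose_shift ((m + M : ℕ) : ℝ) i m
    rw [show (((m + M : ℕ) : ℝ) - m) = (M : ℕ) by push_cast; ring, Ring.choose_natCast,
      Ring.choose_natCast, Ring.choose_natCast, add_comm i m] at hs
    have e : siteDuality (fun r => ((m + M).choose r : ℝ)) (m + i) m
      * binomialRes (m + M) a c (m + i) = ((m + M).choose (m + i) * (m + i).choose m : ℝ)
        / (m + M).choose m * (a / c) ^ (m + i) * (c / (c + a)) ^ (m + M) := by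
      simp only [siteDuality, binomialRes]; ring
    rw [e, hs, mul_div_cancel_left₀ _ hmne, pow_add, one_pow]
    ring
  rw [h0, zero_add, Finset.sum_congr rfl h1, ← Finset.mul_sum, ← add_pow, pow_add]
  have e2 : a / c + 1 = ((c / (c + a)))⁻¹ := by field_simp; ring
  have hp : c / (c + a) ≠ 0 := by positivity
  rw [e2, mul_assoc, mul_assoc, ← mul_pow, mul_inv_cancel₀ hp, one_pow, mul_one, ← mul_pow]
  congr 1
  field_simp
  ring

theorem isProbabilityMeasure_finReservoir {a c : ℝ} (ha : 0 < a) (hc : 0 < c) :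
    IsProbabilityMeasure (finReservoir N a c) := by
  refine isProbabilityMeasure_finsetLaw (fun (r : Fin (N + 1)) _ => binomialRes_nonneg ha hc r) ?_
  simpa [siteDuality] using sum_choose_mul_binomialRes ha hc (Nat.zero_le N)

theorem lintegral_finReservoir {a c : ℝ} (ha : 0 < a) (hc : 0 < c) (m : Fin (N + 1)) :
    ∫⁻ r, ENNReal.ofReal (siteDuality (fun r => (N.choose r : ℝ)) r m) ∂(finReservoir N a c)
      = ENNReal.ofReal ((a / (a + c)) ^ (m : ℕ)) := by
  rw [finReservoir, lintegral_finsetLaw (fun (r : Fin (N + 1)) _ => binomialRes_nonneg ha hc r)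
    (g := fun r : Fin (N + 1) => siteDuality (fun r => (N.choose r : ℝ)) r m)
    (fun r => div_nonneg (Nat.cast_nonneg _) (Nat.cast_nonneg _)),
    sum_choose_mul_binomialRes ha hc (by omega)]

theorem localDuality_sep {α γ δ β : ℝ} (hα : 0 < α) (hγ : 0 < γ) (hδ : 0 < δ) (hβ : 0 < β) :
    LocalDuality Fin.val (finReservoir N α γ) (finReservoir N δ β)
      (Kernel.ofFunOfCountable fun p => finBond N p.1 p.2) (finBond N)
      (fun x m => siteDuality (fun r => (N.choose r : ℝ)) x m)
      (α / (α + γ)) (δ / (β + δ)) where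
  toNat_zero := rfl
  injective := Fin.val_injective
  measurable _ := measurable_of_countable _
  nonneg x m := div_nonneg (Nat.cast_nonneg _) (Nat.cast_nonneg _)
  apply_zero x := by simp [siteDuality]
  left_nonneg := by positivity
  right_nonneg := by positivity
  left m := lintegral_finReservoir hα hγ m
  right m := by rw [lintegral_finReservoir hδ hβ m, add_comm δ β]
  bond x y m l := by
    have hd : ∀ x m, 0 ≤ siteDuality (fun r => (N.choose r : ℝ)) x m :=
      fun x m => div_nonneg (Nat.cast_nonneg _) (Nat.cast_nonneg _)
    have hw : ∀ m : Fin (N + 1), (N.choose m : ℝ) ≠ 0 := fun m => by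
      exact_mod_cast (Nat.choose_pos (Nat.lt_succ_iff.1 m.2)).ne'
    -- A dual redistribution sum may contain terms with `m > N`; they vanish because `x ≤ N`.
    have hx : ∀ (x : Fin (N + 1)) (m : ℕ), (N.choose m : ℝ) = 0 → (x : ℕ).choose m = 0 := by
      intro x m h
      have : N < m := Nat.choose_eq_zero_iff.1 (by exact_mod_cast h)
      exact Nat.choose_eq_zero_of_lt (by omega)
    show ∫⁻ q, _ ∂(finBond N x y) = _
    rw [lintegral_finBond (g := fun r s => siteDuality (fun r => (N.choose r : ℝ)) r m
        * siteDuality (fun r => (N.choose r : ℝ)) s l) (fun _ _ => mul_nonneg (hd _ _) (hd _ _)),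
      lintegral_finBond (g := fun r s => siteDuality (fun r => (N.choose r : ℝ)) x r
        * siteDuality (fun r => (N.choose r : ℝ)) y s) (fun _ _ => mul_nonneg (hd _ _) (hd _ _))]
    congr 1
    simp only [siteDuality]
    have h1 := (isThermalWeight_choose N).bond_sum (hw m) (hw l)
      (choose_two_mul_ne_zero (fin_add_le x y)) (choose_two_mul_ne_zero (fin_add_le m l))
    have h2 := dual_bond_sum (w := fun r => (N.choose r : ℝ))
      (W := fun r => ((2 * N).choose r : ℝ)) (M := m + l) (hx x) (hx y)
    exact h1.trans h2.symm
  conserves m l := ae_finsetLaw fun p hp => (Finset.mem_filter.1 hp).2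

theorem descFactorial_mul_Gamma_sub (x : ℕ) {m : ℕ} (hm : m ≤ N) :
    (x.descFactorial m : ℝ) * (Real.Gamma (N + 1 - m) / Real.Gamma (N + 1))
      = x.choose m / N.choose m := by
  obtain ⟨M, rfl⟩ := Nat.exists_eq_add_of_le' hm
  rw [show (((M + m : ℕ) : ℝ) + 1 - m) = M + 1 by push_cast; ring, Real.Gamma_nat_eq_factorial,
    Real.Gamma_nat_eq_factorial, Nat.descFactorial_eq_factorial_mul_choose, Nat.cast_mul,
    factorial_add_eq]
  have h1 : ((M + m).choose m : ℝ) ≠ 0 := by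
    exact_mod_cast (Nat.choose_pos (Nat.le_add_left _ _)).ne'
  field_simp

theorem generateDualProcesses_thSEP (n N : ℕ) {α γ δ β : ℝ} (hα : 0 < α) (hγ : 0 < γ)
    (hδ : 0 < δ) (hβ : 0 < β) :
    GenerateDualProcesses (thSEP n N α γ δ β) (thSEPDual n N) (dSEP n N α γ δ β) := by
  have := isProbabilityMeasure_finReservoir (N := N) hα hγ
  have := isProbabilityMeasure_finReservoir (N := N) hδ hβ
  have := isProbabilityMeasure_finBond (N := N)
  have : IsMarkovKernel (Kernel.ofFunOfCountable
      fun p : Fin (N + 1) × Fin (N + 1) => finBond N p.1 p.2) :=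
    ⟨fun p => isProbabilityMeasure_finBond p.1 p.2⟩
  have hd : (fun x m : Fin (N + 1) => siteDuality (fun r => (N.choose r : ℝ)) x m)
      = fun x m : Fin (N + 1) => ((x : ℕ).descFactorial m : ℝ)
        * (Real.Gamma (N + 1 - (m : ℕ)) / Real.Gamma (N + 1)) := by
    funext x m
    rw [descFactorial_mul_Gamma_sub _ (Nat.lt_succ_iff.1 m.2), siteDuality]
  have key := (localDuality_sep (N := N) hα hγ hδ hβ).generateDualProcesses (n := n)
    (G := thSEP n N α γ δ β) (G' := thSEPDual n N) ?_ ?_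
  · rw [hd] at key
    exact key
  · rintro f - - η
    rw [thSEP, bulkSEP_eq, finReservoir, finReservoir,
      integral_finsetLaw fun (r : Fin (N + 1)) _ => binomialRes_nonneg hα hγ r,
      integral_finsetLaw fun (r : Fin (N + 1)) _ => binomialRes_nonneg hδ hβ r]
    rfl
  · rintro f - ξ
    rw [thSEPDual, bulkSEP_eq]

end Exclusion

/-! ### Integrals against laws with a density -/

section Densities

theorem lintegral_ofReal_withDensity {p : ℝ → ℝ} (hp : Measurable p) (hp0 : ∀ x, 0 ≤ p x)
    {g : ℝ → ℝ} (hg : Measurable g) :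
    ∫⁻ x, ENNReal.ofReal (g x) ∂(volume.withDensity fun x => ENNReal.ofReal (p x))
      = ∫⁻ x, ENNReal.ofReal (p x * g x) := by
  rw [lintegral_withDensity_eq_lintegral_mul _ hp.ennreal_ofReal hg.ennreal_ofReal]
  simp only [Pi.mul_apply, ENNReal.ofReal_mul (hp0 _)]

theorem integral_withDensity_ofReal {p : ℝ → ℝ} (hp : Measurable p) (hp0 : ∀ x, 0 ≤ p x)
    (g : ℝ → ℝ) : ∫ x, g x ∂(volume.withDensity fun x => ENNReal.ofReal (p x))
      = ∫ x, p x * g x := by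
  rw [integral_withDensity_eq_integral_toReal_smul hp.ennreal_ofReal (ae_of_all _ fun _ => by simp)]
  simp only [ENNReal.toReal_ofReal (hp0 _), smul_eq_mul]

end Densities

/-! ### Gamma reservoirs -/

section Reservoir

/-- The Gamma law with shape `2k` and scale `2T` as a law on `[0, ∞)`. -/
def gammaLaw (k T : ℝ) : Measure ℝ≥0 :=
  (gammaMeasure (2 * k) (1 / (2 * T))).map Real.toNNReal

variable {k T : ℝ}

theorem isProbabilityMeasure_gammaLaw (hk : 0 < k) (hT : 0 < T) :
    IsProbabilityMeasure (gammaLaw k T) := by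
  have := isProbabilityMeasure_gammaMeasure (a := 2 * k) (r := 1 / (2 * T)) (by positivity)
    (by positivity)
  exact Measure.isProbabilityMeasure_map (by fun_prop)

theorem gammaPDFReal_eq_gammaRes (hT : 0 < T) {z : ℝ} (hz : 0 ≤ z) :
    gammaPDFReal (2 * k) (1 / (2 * T)) z = gammaRes k T z := by
  rw [gammaPDFReal, if_pos hz, gammaRes, Real.div_rpow zero_le_one (by positivity), Real.one_rpow,
    show -(1 / (2 * T) * z) = -z / (2 * T) by ring, div_div]

theorem integral_gammaLaw (hk : 0 < k) (hT : 0 < T) {g : ℝ≥0 → ℝ} (hg : Measurable g) :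
    ∫ r, g r ∂(gammaLaw k T) = ∫ z in Set.Ioi (0 : ℝ), gammaRes k T z * g z.toNNReal := by
  rw [gammaLaw, integral_map (by fun_prop) hg.aestronglyMeasurable, gammaMeasure]
  simp only [funext (gammaPDF_eq _ _)]
  have h := integral_withDensity_ofReal (measurable_gammaPDFReal (2 * k) (1 / (2 * T)))
    (gammaPDFReal_nonneg (by positivity) (by positivity)) fun x => g x.toNNReal
  refine h.trans ?_
  rw [← integral_Ici_eq_integral_Ioi, ← setIntegral_eq_integral_of_forall_compl_eq_zero
    (s := Set.Ici (0 : ℝ))]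
  · refine setIntegral_congr_fun measurableSet_Ici fun z hz => ?_
    simp only [gammaPDFReal_eq_gammaRes hT hz]
  · intro z hz
    have : ¬ 0 ≤ z := hz
    simp [gammaPDFReal, this]

/-- Multiplying the Gamma density of shape `2k` by `z^m` gives a multiple of the one of shape `2k +
m`, which integrates to `1`. -/
theorem lintegral_pow_gammaLaw (hk : 0 < k) (hT : 0 < T) (m : ℕ) :
    ∫⁻ r : ℝ≥0, ENNReal.ofReal ((r : ℝ) ^ m
        * (Real.Gamma (2 * k) / Real.Gamma (2 * k + m))) ∂(gammaLaw k T)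
      = ENNReal.ofReal ((2 * T) ^ m) := by
  have hG := Real.Gamma_pos_of_pos (show 0 < 2 * k by positivity)
  have hG' := Real.Gamma_pos_of_pos (show 0 < 2 * k + m by positivity)
  have hr : 0 < 1 / (2 * T) := by positivity
  rw [gammaLaw, lintegral_map (by fun_prop) (by fun_prop), gammaMeasure]
  simp only [funext (gammaPDF_eq _ _)]
  refine (lintegral_ofReal_withDensity (measurable_gammaPDFReal (2 * k) (1 / (2 * T)))
    (gammaPDFReal_nonneg (by positivity) (by positivity))
    (g := fun x => ((x.toNNReal : ℝ)) ^ m * (Real.Gamma (2 * k) / Real.Gamma (2 * k + m)))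
    (by fun_prop)).trans ?_
  have e : ∀ᵐ x : ℝ, ENNReal.ofReal (gammaPDFReal (2 * k) (1 / (2 * T)) x * ((x.toNNReal : ℝ) ^ m
        * (Real.Gamma (2 * k) / Real.Gamma (2 * k + m))))
      = ENNReal.ofReal ((2 * T) ^ m) * gammaPDF (2 * k + m) (1 / (2 * T)) x := by
    -- The point `0` is discarded because splitting the real power of `x` needs `x > 0`.
    filter_upwards [compl_mem_ae_iff.2 (measure_singleton (0 : ℝ))] with x hx0
    have hx0 : x ≠ 0 := hx0
    rw [gammaPDF, ← ENNReal.ofReal_mul (by positivity)]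
    congr 1
    rw [gammaPDFReal, gammaPDFReal]
    split_ifs with hx
    · have hx' : 0 < x := lt_of_le_of_ne hx (Ne.symm hx0)
      rw [Real.coe_toNNReal _ hx, show 2 * k + m - 1 = (2 * k - 1) + m by ring,
        Real.rpow_add hx', Real.rpow_add hr, Real.rpow_natCast, Real.rpow_natCast, one_div, inv_pow]
      field_simp
    · simp
  rw [lintegral_congr_ae e, lintegral_const_mul _ (by unfold gammaPDF; fun_prop),
    lintegral_gammaPDF_eq_one (by positivity) hr, mul_one]

end Reservoir

/-! ### Beta redistribution of energy on a bond -/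

section Redistribution

/-- The split of a total energy into the fractions `x` and `1 - x`. -/
def splitEnergy (p : (ℝ≥0 × ℝ≥0) × ℝ) : ℝ≥0 × ℝ≥0 :=
  (p.2.toNNReal * (p.1.1 + p.1.2), (1 - p.2).toNNReal * (p.1.1 + p.1.2))

@[fun_prop]
theorem measurable_splitEnergy : Measurable splitEnergy := by
  unfold splitEnergy; fun_prop

/-- The kernel that splits the energy of a bond according to the Beta law. -/
def betaBondKernel (a : ℝ) : Kernel (ℝ≥0 × ℝ≥0) (ℝ≥0 × ℝ≥0) :=
  (Kernel.id ×ₖ Kernel.const _ (betaMeasure a a)).map splitEnergy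

variable {a : ℝ}

theorem betaBondKernel_apply (ha : 0 < a) (p : ℝ≥0 × ℝ≥0) :
    betaBondKernel a p = (betaMeasure a a).map fun x => splitEnergy (p, x) := by
  have := isProbabilityMeasureBeta ha ha
  rw [betaBondKernel, Kernel.map_apply _ measurable_splitEnergy, Kernel.prod_apply,
    Kernel.id_apply, Kernel.const_apply, Measure.dirac_prod,
    Measure.map_map measurable_splitEnergy measurable_prodMk_left]
  rfl

theorem isMarkovKernel_betaBondKernel (ha : 0 < a) : IsMarkovKernel (betaBondKernel a) := by
  have := isProbabilityMeasureBeta ha ha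
  exact Kernel.IsMarkovKernel.map _ measurable_splitEnergy

theorem betaPDFReal_nonneg (ha : 0 < a) (x : ℝ) : 0 ≤ betaPDFReal a a x := by
  by_cases h : 0 < x ∧ x < 1
  · exact (betaPDFReal_pos h.1 h.2 ha ha).le
  · simp [betaPDFReal, h]

theorem integral_betaBondKernel (ha : 0 < a) (p : ℝ≥0 × ℝ≥0) {g : ℝ≥0 × ℝ≥0 → ℝ}
    (hg : Measurable g) : ∫ q, g q ∂(betaBondKernel a p)
      = ∫ x in (0 : ℝ)..1, g (x.toNNReal * (p.1 + p.2), (1 - x).toNNReal * (p.1 + p.2))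
          * betaPDFReal a a x := by
  rw [betaBondKernel_apply ha, integral_map (by fun_prop) hg.aestronglyMeasurable, betaMeasure]
  refine (integral_withDensity_ofReal (measurable_betaPDFReal a a) (betaPDFReal_nonneg ha)
    fun x => g (splitEnergy (p, x))).trans ?_
  rw [intervalIntegral.integral_of_le zero_le_one,
    ← setIntegral_eq_integral_of_forall_compl_eq_zero (s := Set.Ioc (0 : ℝ) 1)]
  · refine setIntegral_congr_fun measurableSet_Ioc fun x _ => ?_
    rw [mul_comm]; rfl
  · intro x hx
    have : ¬ (0 < x ∧ x < 1) := fun h => hx ⟨h.1, h.2.le⟩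
    simp [betaPDFReal, this]

/-- The factor `t^m (1 - t)^l` turns the Beta(a, a) density into a multiple of the Beta(a + m, a +
l) density. The constants `c` and `c'` are there for the Gamma ratios of the duality function. -/
theorem lintegral_betaBondKernel (ha : 0 < a) (x y : ℝ≥0) (m l : ℕ) {c c' : ℝ} (hc : 0 ≤ c)
    (hc' : 0 ≤ c') :
    ∫⁻ q, ENNReal.ofReal (((q.1 : ℝ) ^ m * c) * ((q.2 : ℝ) ^ l * c')) ∂(betaBondKernel a (x, y))
      = ENNReal.ofReal ((x + y : ℝ) ^ (m + l) * (c * c') * (beta (a + m) (a + l) / beta a a)) := by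
  have hB := beta_pos ha ha
  have hB' := beta_pos (show 0 < a + m by positivity) (show 0 < a + l by positivity)
  rw [betaBondKernel_apply ha, lintegral_map (by fun_prop) (by fun_prop), betaMeasure]
  refine (lintegral_ofReal_withDensity (measurable_betaPDFReal a a) (betaPDFReal_nonneg ha)
    (g := fun t => (((splitEnergy ((x, y), t)).1 : ℝ) ^ m * c)
      * (((splitEnergy ((x, y), t)).2 : ℝ) ^ l * c')) (by fun_prop)).trans ?_
  have e : ∀ t : ℝ, ENNReal.ofReal (betaPDFReal a a t * ((((splitEnergy ((x, y), t)).1 : ℝ) ^ m * c)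
      * (((splitEnergy ((x, y), t)).2 : ℝ) ^ l * c')))
      = ENNReal.ofReal ((x + y : ℝ) ^ (m + l) * (c * c') * (beta (a + m) (a + l) / beta a a))
        * betaPDF (a + m) (a + l) t := by
    intro t
    rw [betaPDF, ← ENNReal.ofReal_mul (by positivity)]
    congr 1
    rw [betaPDFReal, betaPDFReal]
    split_ifs with h
    · have h1 : 0 < 1 - t := by linarith [h.2]
      simp only [splitEnergy, NNReal.coe_mul, NNReal.coe_add, Real.coe_toNNReal _ h.1.le,
        Real.coe_toNNReal _ h1.le]
      rw [show a + m - 1 = (a - 1) + m by ring, show a + l - 1 = (a - 1) + l by ring,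
        Real.rpow_add h.1, Real.rpow_add h1, Real.rpow_natCast, Real.rpow_natCast, mul_pow, mul_pow,
        pow_add]
      field_simp
    · simp
  simp only [e]
  rw [lintegral_const_mul _ (by unfold betaPDF; fun_prop),
    lintegral_betaPDF_eq_one (by positivity) (by positivity), mul_one]

end Redistribution

/-! ### Brownian energy process -/

section Energy

variable {k : ℝ}

theorem gamma_ratio_eq {a : ℝ} (ha : 0 < a) (m : ℕ) :
    Real.Gamma a / Real.Gamma (a + m) = 1 / (Ring.multichoose a m * m.factorial) := by
  rw [multichoose_mul_factorial ha, one_div_div]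

theorem convSum_pow_div_factorial (x y : ℝ) (M : ℕ) :
    convSum (fun m l => x ^ m / m.factorial * (y ^ l / l.factorial)) M
      = (x + y) ^ M / M.factorial := by
  rw [(Commute.all x y).add_pow', Finset.sum_div]
  refine Finset.sum_congr rfl fun p hp => ?_
  rw [Finset.HasAntidiagonal.mem_antidiagonal] at hp
  subst hp
  have h1 : ((p.1 + p.2).choose p.1 : ℝ) ≠ 0 := by
    exact_mod_cast (Nat.choose_pos (Nat.le_add_right _ _)).ne'
  have h := factorial_add_eq p.2 p.1
  rw [add_comm p.2 p.1] at h
  rw [h, nsmul_eq_mul]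
  field_simp

/-- The single-site duality function of the Brownian energy process. -/
def energyDuality (k : ℝ) (z : ℝ≥0) (m : ℕ) : ℝ :=
  (z : ℝ) ^ m * (Real.Gamma (2 * k) / Real.Gamma (2 * k + m))

theorem energyDuality_nonneg (hk : 0 < k) (z : ℝ≥0) (m : ℕ) : 0 ≤ energyDuality k z m := by
  have hG := Real.Gamma_pos_of_pos (show 0 < 2 * k by positivity)
  have hG' := Real.Gamma_pos_of_pos (show 0 < 2 * k + m by positivity)
  unfold energyDuality
  positivity

/-- Both sides equal `(x + y)^{m+l} Γ(4k) / Γ(4k + m + l)`. On the left the Beta functions are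
written with Gamma functions; on the right the multichoose weights cancel the Gamma ratios up to
factorials, and the binomial theorem remains. -/
theorem energy_bond_sum (hk : 0 < k) (x y : ℝ≥0) (m l : ℕ) :
    (x + y : ℝ) ^ (m + l) * ((Real.Gamma (2 * k) / Real.Gamma (2 * k + m))
        * (Real.Gamma (2 * k) / Real.Gamma (2 * k + l)))
        * (beta (2 * k + m) (2 * k + l) / beta (2 * k) (2 * k))
      = convSum (fun r s => energyDuality k x r * energyDuality k y s
        * (Ring.multichoose (2 * k) r * Ring.multichoose (2 * k) s
          / Ring.multichoose (2 * (2 * k)) (m + l))) (m + l) := by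
  have ha : 0 < 2 * k := by positivity
  have hW := multichoose_pos (show 0 < 2 * (2 * k) by positivity) (m + l)
  have e : convSum (fun r s => energyDuality k x r * energyDuality k y s
        * (Ring.multichoose (2 * k) r * Ring.multichoose (2 * k) s
          / Ring.multichoose (2 * (2 * k)) (m + l))) (m + l)
      = (x + y : ℝ) ^ (m + l) / (m + l).factorial / Ring.multichoose (2 * (2 * k)) (m + l) := by
    rw [← convSum_pow_div_factorial, convSum, convSum, Finset.sum_div]
    refine Finset.sum_congr rfl fun q _ => ?_
    have h1 := (multichoose_pos ha q.1).ne'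
    have h2 := (multichoose_pos ha q.2).ne'
    rw [energyDuality, energyDuality, gamma_ratio_eq ha, gamma_ratio_eq ha]
    field_simp
  have hM := gamma_ratio_eq (show 0 < 2 * (2 * k) by positivity) (m + l)
  have hG := Real.Gamma_pos_of_pos ha
  have hG1 := Real.Gamma_pos_of_pos (show 0 < 2 * k + m by positivity)
  have hG2 := Real.Gamma_pos_of_pos (show 0 < 2 * k + l by positivity)
  have hG3 := Real.Gamma_pos_of_pos (show 0 < 2 * (2 * k) by positivity)
  have hG4 := Real.Gamma_pos_of_pos (show 0 < 2 * (2 * k) + (m + l : ℕ) by positivity)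
  have e3 : (x + y : ℝ) ^ (m + l) / (m + l).factorial / Ring.multichoose (2 * (2 * k)) (m + l)
      = (x + y : ℝ) ^ (m + l) * (1 / (Ring.multichoose (2 * (2 * k)) (m + l)
        * (m + l).factorial)) := by field_simp
  rw [e, e3, ← hM, beta, beta, show 2 * k + m + (2 * k + l) = 2 * (2 * k) + (m + l : ℕ) by
    push_cast; ring, ← two_mul (2 * k)]
  field_simp

theorem localDuality_bep (hk : 0 < k) {Ta Tb : ℝ} (hTa : 0 < Ta) (hTb : 0 < Tb) :
    LocalDuality id (gammaLaw k Ta) (gammaLaw k Tb) (betaBondKernel (2 * k)) (natBond (nuSIP k))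
      (energyDuality k) (2 * Ta) (2 * Tb) where
  toNat_zero := rfl
  injective := Function.injective_id
  measurable m := by unfold energyDuality; fun_prop
  nonneg := energyDuality_nonneg hk
  apply_zero x := by
    have := (Real.Gamma_pos_of_pos (show 0 < 2 * k by positivity)).ne'
    simp [energyDuality, this]
  left_nonneg := by positivity
  right_nonneg := by positivity
  left := lintegral_pow_gammaLaw hk hTa
  right := lintegral_pow_gammaLaw hk hTb
  bond x y m l := by
    have hG : ∀ m : ℕ, 0 ≤ Real.Gamma (2 * k) / Real.Gamma (2 * k + m) := fun m =>
      (div_pos (Real.Gamma_pos_of_pos (by positivity)) (Real.Gamma_pos_of_pos (by positivity))).le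
    rw [(isRedistribution_nuSIP hk).lintegral_natBond
        (g := fun q => energyDuality k x q.1 * energyDuality k y q.2)
        (fun q => mul_nonneg (energyDuality_nonneg hk _ _) (energyDuality_nonneg hk _ _)),
      ← energy_bond_sum hk]
    exact lintegral_betaBondKernel (by positivity) x y m l (hG m) (hG l)
  conserves := natBond_conserves

theorem generateDualProcesses_thBEP (n : ℕ) (hk : 0 < k) {Ta Tb : ℝ} (hTa : 0 < Ta)
    (hTb : 0 < Tb) :
    GenerateDualProcesses (thBEP n k Ta Tb) (thBEPDual n k) (dBEP n k Ta Tb) := by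
  have := isProbabilityMeasure_gammaLaw hk hTa
  have := isProbabilityMeasure_gammaLaw hk hTb
  have := (isRedistribution_nuSIP hk).isProbabilityMeasure_natBond
  have := isMarkovKernel_betaBondKernel (show 0 < 2 * k by positivity)
  refine (localDuality_bep hk hTa hTb).generateDualProcesses (n := n)
    (G := thBEP n k Ta Tb) (G' := thBEPDual n k) ?_ ?_
  · rintro f hf - η
    have hsite : ∀ i, Measurable fun r => f (Function.update η i r) - f η := fun i =>
      (hf.comp (measurable_update η)).sub_const _
    have hbond : ∀ i, Measurable fun q : ℝ≥0 × ℝ≥0 => f (setBond η i q.1 q.2) - f η := fun i =>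
      (hf.comp (measurable_setBond_right η i)).sub_const _
    rw [thBEP, integral_gammaLaw hk hTa (hsite _), integral_gammaLaw hk hTb (hsite _)]
    simp only [integral_betaBondKernel (show 0 < 2 * k by positivity) _ (hbond _)]
  · rintro f - ξ
    rw [thBEPDual, (isRedistribution_nuSIP hk).bulk_eq]

end Energy

/-! ### The KMP model as the case `k = 1/2` -/

section KMP

theorem gammaRes_one_half (T z : ℝ) :
    gammaRes (1 / 2) (T / 2) z = Real.exp (-z / T) / T := by
  rw [gammaRes, show 2 * (1 / 2 : ℝ) = 1 by norm_num, show 2 * (T / 2) = T by ring]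
  simp only [Real.rpow_one, Real.Gamma_one, sub_self, Real.rpow_zero, mul_one]
  ring

theorem betaPDFReal_one_one {x : ℝ} (h0 : 0 < x) (h1 : x < 1) : betaPDFReal 1 1 x = 1 := by
  rw [betaPDFReal, if_pos ⟨h0, h1⟩, beta, one_add_one_eq_two, Real.Gamma_one, Real.Gamma_two]
  simp

theorem thBEP_one_half (n : ℕ) (Ta Tb : ℝ) :
    thBEP n (1 / 2) (Ta / 2) (Tb / 2) = kmp n Ta Tb := by
  funext f z
  rw [thBEP, kmp]
  simp only [gammaRes_one_half]
  congr 2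
  refine Finset.sum_congr rfl fun i _ => ?_
  -- The Beta(1, 1) density equals `1` only on the open interval, so the endpoint `1` is removed
  -- first.
  rw [intervalIntegral.integral_of_le zero_le_one, intervalIntegral.integral_of_le zero_le_one,
    integral_Ioc_eq_integral_Ioo, integral_Ioc_eq_integral_Ioo]
  refine setIntegral_congr_fun measurableSet_Ioo fun x hx => ?_
  simp only [show 2 * (1 / 2 : ℝ) = 1 by norm_num, betaPDFReal_one_one hx.1 hx.2, mul_one]

theorem nuSIP_one_half : nuSIP (1 / 2) = nuUniform := by
  funext r E
  rw [nuSIP, nuUniform, multichoose_sub_eq, multichoose_sub_eq, multichoose_sub_eq,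
    show 2 * (1 / 2 : ℝ) = 1 by norm_num, show 4 * (1 / 2 : ℝ) = 2 by norm_num,
    Ring.multichoose_one, Ring.multichoose_one, Ring.multichoose_two, mul_one]

theorem dBEP_one_half (n : ℕ) (Ta Tb : ℝ) :
    dBEP n (1 / 2) (Ta / 2) (Tb / 2) = dKMP n Ta Tb := by
  funext z ξ
  rw [dBEP, dKMP, show 2 * (Ta / 2) = Ta by ring, show 2 * (Tb / 2) = Tb by ring]
  congr 2
  refine Finset.prod_congr rfl fun i _ => ?_
  rw [show 2 * (1 / 2 : ℝ) = 1 by norm_num, Real.Gamma_one, add_comm, Real.Gamma_nat_eq_factorial,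
    mul_one_div]

theorem thBEPDual_one_half (n : ℕ) : thBEPDual n (1 / 2) = kmpDual n := by
  funext f ξ
  rw [thBEPDual, kmpDual, nuSIP_one_half]

end KMP

end ThermalDuality

end

theorem mainTheorem6 (n : ℕ) :
    -- inclusion walkers
    (∀ k α γ δ β : ℝ, 0 < k → 0 < α → α < γ → 0 < δ → δ < β →
      ThermalDuality.GenerateDualProcesses
        (ThermalDuality.thSIP n k α γ δ β) (ThermalDuality.thSIPDual n k)
        (ThermalDuality.dSIP n k α γ δ β)) ∧
    -- exclusion walkers, N = 2j
    (∀ (N : ℕ) (α γ δ β : ℝ), 0 < α → 0 < γ → 0 < δ → 0 < β →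
      ThermalDuality.GenerateDualProcesses
        (ThermalDuality.thSEP n N α γ δ β) (ThermalDuality.thSEPDual n N)
        (ThermalDuality.dSEP n N α γ δ β)) ∧
    -- independent walkers
    (∀ α γ δ β : ℝ, 0 < α → 0 < γ → 0 < δ → 0 < β →
      ThermalDuality.GenerateDualProcesses
        (ThermalDuality.thIRW n α γ δ β) (ThermalDuality.thIRWDual n)
        (ThermalDuality.dIRW n α γ δ β)) ∧
    -- Brownian energy process
    (∀ k Ta Tb : ℝ, 0 < k → 0 < Ta → 0 < Tb →
      ThermalDuality.GenerateDualProcesses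
        (ThermalDuality.thBEP n k Ta Tb) (ThermalDuality.thBEPDual n k)
        (ThermalDuality.dBEP n k Ta Tb)) ∧
    -- the case k = 1/2 of the latter is the KMP model
    (∀ Ta Tb : ℝ, 0 < Ta → 0 < Tb →
      ThermalDuality.thBEP n (1 / 2) (Ta / 2) (Tb / 2) = ThermalDuality.kmp n Ta Tb ∧
      ThermalDuality.thBEPDual n (1 / 2) = ThermalDuality.kmpDual n ∧
      ThermalDuality.dBEP n (1 / 2) (Ta / 2) (Tb / 2) = ThermalDuality.dKMP n Ta Tb ∧
      ThermalDuality.GenerateDualProcesses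
        (ThermalDuality.kmp n Ta Tb) (ThermalDuality.kmpDual n)
        (ThermalDuality.dKMP n Ta Tb)) := by
  refine ⟨fun k α γ δ β hk hα hαγ hδ hδβ =>
      ThermalDuality.generateDualProcesses_thSIP n hk hα hαγ hδ hδβ,
    fun N α γ δ β hα hγ hδ hβ => ThermalDuality.generateDualProcesses_thSEP n N hα hγ hδ hβ,
    fun α γ δ β hα hγ hδ hβ => ThermalDuality.generateDualProcesses_thIRW n hα hγ hδ hβ,
    fun k Ta Tb hk hTa hTb => ThermalDuality.generateDualProcesses_thBEP n hk hTa hTb,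
    fun Ta Tb hTa hTb => ⟨ThermalDuality.thBEP_one_half n Ta Tb,
      ThermalDuality.thBEPDual_one_half n, ThermalDuality.dBEP_one_half n Ta Tb, ?_⟩⟩
  have h := ThermalDuality.generateDualProcesses_thBEP n (k := 1 / 2) (by norm_num)
    (half_pos hTa) (half_pos hTb)
  rwa [ThermalDuality.thBEP_one_half, ThermalDuality.thBEPDual_one_half,
    ThermalDuality.dBEP_one_half] at h
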